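/- Let $1<\alpha<3$, $\beta>0$, $\lambda>0$ and $C_1>0$. There is a constant $C>0$, depending only on $\alpha,\beta,\lambda,C_1$, such that the following holds. Let $f_0:\mathbb{R}^3\times\mathbb{R}^3\to\mathbb{R}$ be a measurable function with $$0\le f_0(x,v)\le C_1\,e^{-\lambda|v|^2}\frac{1}{(1+|x|)^{\alpha}}\qquad\text{for all }x,v\in\mathbb{R}^3 .$$ For real $N\ge 1$ put $f_0^N(x,v)=f_0(x,v)\,\chi_{\{|x|\le N^\beta\}}(x)\,\chi_{\{|v|\le N\}}(v)$. Let $T>0$ and let $(X^N,V^N,f^N)$ be a solution on $[0,T]$ of the partial dynamics (the gravitational Vlasov--Poisson system in characteristic form with initial datum $f_0^N$): for each $(x,v)\in\mathbb{R}^3\times\mathbb{R}^3$ and $t\in[0,T]$, writing $X^N(t)=X^N(t,x,v)$ and $V^N(t)=V^N(t,x,v)$, $$\dot X^N(t)=V^N(t),\qquad \dot V^N(t)=G^N(X^N(t),t),\qquad (X^N(0),V^N(0))=(x,v),\qquad f^N(X^N(t),V^N(t),t)=f_0^N(x,v),$$ $$G^N(x,t)=-\int_{\mathbb{R}^3}\frac{x-y}{|x-y|^3}\,\rho^N(y,t)\,dy,\qquad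 \rho^N(x,t)=\int_{\mathbb{R}^3}f^N(x,v,t)\,dv,$$ where $(t,x,v)\mapsto(X^N(t,x,v),V^N(t,x,v))$ is continuous on $[0,T]\times\mathbb{R}^3\times\mathbb{R}^3$ and, for each $t\in[0,T]$, $(x,v)\mapsto(X^N(t,x,v),V^N(t,x,v))$ is a bijection of $\mathbb{R}^3\times\mathbb{R}^3$. Then for every $t\in[0,T]$ the function $|v|^2f^N(x,v,t)$ is integrable over $\mathbb{R}^3\times\mathbb{R}^3$ and $$\frac12\int dx\int dv\,|v|^2 f^N(x,v,t)\le C\,N^{\frac73\beta(3-\alpha)} .$$ In particular the bound is uniform in $t$, $T$ and $N$, and it holds for all $t\ge 0$ for solutions that are global in time. -/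

import Mathlib

open MeasureTheory Set

noncomputable section

namespace GravVP

/-- Physical (or velocity) space `ℝ³` with the Euclidean norm. -/
abbrev E : Type := EuclideanSpace ℝ (Fin 3)

/-- The truncated datum `f₀(x,v) χ_{|x| ≤ N^β}(x) χ_{|v| ≤ N}(v)`. -/
def truncate (f₀ : E → E → ℝ) (β N : ℝ) (x v : E) : ℝ :=
  f₀ x v * ({y : E | ‖y‖ ≤ N ^ β}.indicator 1 x : ℝ) * ({w : E | ‖w‖ ≤ N}.indicator 1 v : ℝ)

/-- The spatial density `ρ(x,t) = ∫ f(x,v,t) dv`. -/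
def density (f : E → E → ℝ → ℝ) (x : E) (t : ℝ) : ℝ :=
  ∫ v, f x v t

/-- The gravitational field `G(x,t) = - ∫ (x-y)/|x-y|³ ρ(y,t) dy`. -/
def field (f : E → E → ℝ → ℝ) (x : E) (t : ℝ) : E :=
  - ∫ y, (density f y t / ‖x - y‖ ^ 3) • (x - y)

/-- The kinetic energy `½ ∫ dx ∫ dv |v|² f(x,v,t)`. -/
def kineticEnergy (f : E → E → ℝ → ℝ) (t : ℝ) : ℝ :=
  1 / 2 * ∫ x, ∫ v, ‖v‖ ^ 2 * f x v t

/-- `(X, V, f)` is a solution on `[0,T]`, with initial datum `g`, of the gravitational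
Vlasov-Poisson system in characteristic form.

The argument order is `X t x v`, `V t x v` (the characteristic at time `t` that starts from
`(x,v)` at time `0`) and `f x v t`. The characteristics form a continuous flow of the phase space:
at each time exactly one of them passes through each point, so that the condition `transport`
determines `f(·,·,t)` on the whole phase space. At `t = 0` and `t = T` the time derivatives are
one-sided. -/
structure IsSolution (g : E → E → ℝ) (T : ℝ) (X V : ℝ → E → E → E) (f : E → E → ℝ → ℝ) :
    Prop where
  continuous_flow : ContinuousOn
    (fun p : ℝ × E × E => (X p.1 p.2.1 p.2.2, V p.1 p.2.1 p.2.2)) (Icc 0 T ×ˢ univ)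
  bijective_flow : ∀ t ∈ Icc 0 T,
    Function.Bijective (fun p : E × E => (X t p.1 p.2, V t p.1 p.2))
  init_X : ∀ x v, X 0 x v = x
  init_V : ∀ x v, V 0 x v = v
  deriv_X : ∀ x v, ∀ t ∈ Icc 0 T,
    HasDerivWithinAt (fun s => X s x v) (V t x v) (Icc 0 T) t
  deriv_V : ∀ x v, ∀ t ∈ Icc 0 T,
    HasDerivWithinAt (fun s => V s x v) (field f (X t x v) t) (Icc 0 T) t
  transport : ∀ x v, ∀ t ∈ Icc 0 T, f (X t x v) (V t x v) t = g x v

end GravVP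

end

namespace GravVP

/-! The engine is conservation of energy. With kinetic energy `K` and `P = ½ ∬ f f' / |x - y|`, the
quantity `K - P` is constant and `P(0) ≥ 0`, so `K(t) ≤ K(0) + P(t)`. Attraction gives `P` the wrong
sign, so it must be absorbed. The flow transports `f` and preserves volume, hence keeps its mass `m
≤ M` and its bound `f ≤ C`. Splitting phase space into far particles, near fast particles and near
slow particles bounds the potential at any point by mass, kinetic energy and `C`
(`IsBoundedDatum.integral_inv_soft_le`). Optimizing the two thresholds gives `P ≤ K / 2 + const * M
^ (7/3)`, so `K(t) ≤ 2 K(0) + const * M ^ (7/3)` (`IsSolution.kineticEnergy_le`). Mass and initial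
kinetic energy of the truncated datum are both `O(N ^ (β (3 - α)))` (`moment_truncate_le`).

Two points need care, since neither `f` nor the field is assumed smooth.

Volume preservation is not a hypothesis, and the field is only log-Lipschitz. The kernel is softened
at scale `ε = 1 / (n + 1)`, which makes the field Lipschitz with a constant `L ^ 2` of order `log
n`, and the motion is compared with a splitting scheme made of volume preserving shears. As the
equation is of second order, errors measured by `L |x| + |v|` grow like `exp (2 T L)` with `L ~
√(log n)`. This is smaller than any positive power of `n`, so the consistency error, `1 / n` up to
powers of `L`, wins for every `T` (`measurePreserving_of_boundedDensity`).

The energy identity is differentiated in particle labels with the softened potential, whose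
derivative is bounded. The defect is the velocity bound times the force error `ε log (1 / ε)`; it
vanishes as `ε → 0`, so the velocity bound does not enter the final constant. -/

open Filter Topology

/-! ### The splitting scheme as a composition of shears -/

/-- One step of the splitting scheme for `x' = v, v' = F x t` on `[a, b]`: a kick of the velocity
by the field at the frozen position, followed by free transport. -/
noncomputable def kickDrift (F : E → ℝ → E) (a b : ℝ) (z : E × E) : E × E :=
  (z.1 + (b - a) • (z.2 + ∫ s in a..b, F z.1 s), z.2 + ∫ s in a..b, F z.1 s)

/-- The iterated splitting scheme with step `h`. -/
noncomputable def splitting (F : E → ℝ → E) (h : ℝ) : ℕ → E × E → E × E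
  | 0 => id
  | n + 1 => kickDrift F (n * h) ((n + 1) * h) ∘ splitting F h n

/-- Kick and drift are shears: each translates one coordinate by a measurable function of the other.
No regularity of `F` in space is needed. The drift is a skew product after exchanging the factors,
hence the conjugation by `Prod.swap`. -/
lemma measurePreserving_kickDrift {F : E → ℝ → E} (hF : Measurable (Function.uncurry F))
    (a b : ℝ) : MeasurePreserving (kickDrift F a b) volume volume := by
  have hI : Measurable fun x : E => ∫ s in a..b, F x s := by
    simp only [intervalIntegral]
    exact ((hF.stronglyMeasurable.integral_prod_right (ν := volume.restrict (Ioc a b))).sub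
      (hF.stronglyMeasurable.integral_prod_right (ν := volume.restrict (Ioc b a)))).measurable
  have h1 : MeasurePreserving (fun z : E × E => (z.1, (∫ s in a..b, F z.1 s) + z.2))
      volume volume := by
    refine (MeasurePreserving.id volume).skew_product
      (g := fun (x : E) (v : E) => (∫ s in a..b, F x s) + v) ?_ ?_
    · exact (hI.comp measurable_fst).add measurable_snd
    · exact Eventually.of_forall fun x => (measurePreserving_add_left volume _).map_eq
  have h2 : MeasurePreserving (fun z : E × E => (z.1, (b - a) • z.1 + z.2)) volume volume := by
    refine (MeasurePreserving.id volume).skew_product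
      (g := fun (x : E) (v : E) => (b - a) • x + v) ?_ ?_
    · exact (measurable_fst.const_smul (b - a)).add (measurable_snd : Measurable fun z : E × E => z.2)
    · exact Eventually.of_forall fun x => (measurePreserving_add_left volume _).map_eq
  have hs : MeasurePreserving (Prod.swap : E × E → E × E) volume volume :=
    Measure.measurePreserving_swap
  have := hs.comp (h2.comp (hs.comp h1))
  convert this using 1
  ext1 z
  simp [kickDrift, add_comm]

lemma measurePreserving_splitting {F : E → ℝ → E} (hF : Measurable (Function.uncurry F))
    (h : ℝ) (n : ℕ) : MeasurePreserving (splitting F h n) volume volume := by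
  induction n with
  | zero => exact MeasurePreserving.id _
  | succ n ih => exact (measurePreserving_kickDrift hF _ _).comp ih

/-- `(x, v)` solves `x' = v, v' = G x t` on `[0, T]`. -/
structure IsTrajectory (G : E → ℝ → E) (T : ℝ) (x v : ℝ → E) : Prop where
  deriv_fst : ∀ t ∈ Icc 0 T, HasDerivWithinAt x (v t) (Icc 0 T) t
  deriv_snd : ∀ t ∈ Icc 0 T, HasDerivWithinAt v (G (x t) t) (Icc 0 T) t

/-! ### Error of the splitting scheme along a trajectory -/

section bounded

variable {G : E → ℝ → E} {B T : ℝ} {x v : ℝ → E}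

lemma IsTrajectory.norm_snd_sub_le (h : IsTrajectory G T x v) (hB : ∀ y s, ‖G y s‖ ≤ B)
    {a b : ℝ} (ha : 0 ≤ a) (hab : a ≤ b) (hb : b ≤ T) : ‖v b - v a‖ ≤ B * (b - a) := by
  refine norm_image_sub_le_of_norm_deriv_le_segment' (f' := fun t => G (x t) t) (fun t ht => ?_)
    (fun t _ => hB _ _) b ⟨hab, le_rfl⟩
  exact (h.deriv_snd t ⟨ha.trans ht.1, ht.2.trans hb⟩).mono (Icc_subset_Icc ha hb)

lemma IsTrajectory.norm_snd_le (h : IsTrajectory G T x v) (hB : ∀ y s, ‖G y s‖ ≤ B)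
    {t : ℝ} (ht : t ∈ Icc 0 T) : ‖v t‖ ≤ ‖v 0‖ + B * T := by
  have h1 := h.norm_snd_sub_le hB le_rfl ht.1 ht.2
  have hB0 : 0 ≤ B := (norm_nonneg _).trans (hB 0 0)
  have h2 : B * (t - 0) ≤ B * T := by gcongr; linarith [ht.2]
  have h3 := norm_le_norm_add_norm_sub' (v t) (v 0)
  linarith

lemma IsTrajectory.norm_fst_sub_le (h : IsTrajectory G T x v) (hB : ∀ y s, ‖G y s‖ ≤ B)
    {a b : ℝ} (ha : 0 ≤ a) (hab : a ≤ b) (hb : b ≤ T) :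
    ‖x b - x a‖ ≤ (‖v 0‖ + B * T) * (b - a) := by
  refine norm_image_sub_le_of_norm_deriv_le_segment' (f' := fun t => v t) (fun t ht => ?_)
    (fun t ht => h.norm_snd_le hB ⟨ha.trans ht.1, ht.2.le.trans hb⟩) b ⟨hab, le_rfl⟩
  exact (h.deriv_fst t ⟨ha.trans ht.1, ht.2.trans hb⟩).mono (Icc_subset_Icc ha hb)

/-- The drift of the scheme uses the velocity after the kick, so the comparison is with the straight
line of velocity `v b`. The velocity varies by at most `B * (b - a)`, whence a second order error.
-/
lemma IsTrajectory.norm_fst_sub_smul_le (h : IsTrajectory G T x v) (hB : ∀ y s, ‖G y s‖ ≤ B)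
    {a b : ℝ} (ha : 0 ≤ a) (hab : a ≤ b) (hb : b ≤ T) :
    ‖x b - x a - (b - a) • v b‖ ≤ B * (b - a) ^ 2 := by
  have hB0 : 0 ≤ B := (norm_nonneg _).trans (hB 0 0)
  have key := norm_image_sub_le_of_norm_deriv_le_segment' (f := fun t => x t - (t - a) • v b)
    (f' := fun t => v t - (1 : ℝ) • v b) (a := a) (b := b) (C := B * (b - a)) (fun t ht => ?_)
    (fun t ht => ?_) b ⟨hab, le_rfl⟩
  · simpa [sub_right_comm, pow_two, mul_assoc] using key
  · refine HasDerivWithinAt.sub ?_ ?_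
    · exact (h.deriv_fst t ⟨ha.trans ht.1, ht.2.trans hb⟩).mono (Icc_subset_Icc ha hb)
    · exact (((hasDerivWithinAt_id t _).sub_const a).smul_const (v b))
  · rw [one_smul, norm_sub_rev]
    refine (h.norm_snd_sub_le hB (ha.trans ht.1) ht.2.le hb).trans ?_
    gcongr
    exact ht.1

lemma IsTrajectory.integral_eq (h : IsTrajectory G T x v) (hG : Measurable (Function.uncurry G))
    (hB : ∀ y s, ‖G y s‖ ≤ B) {a b : ℝ} (ha : 0 ≤ a) (hab : a ≤ b) (hb : b ≤ T) :
    IntervalIntegrable (fun s => G (x s) s) volume a b ∧ ∫ s in a..b, G (x s) s = v b - v a := by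
  have hsub : Icc a b ⊆ Icc 0 T := Icc_subset_Icc ha hb
  have hxc : ContinuousOn x (Icc a b) := fun t ht =>
    ((h.deriv_fst t (hsub ht)).mono hsub).continuousWithinAt
  have hvc : ContinuousOn v (Icc a b) := fun t ht =>
    ((h.deriv_snd t (hsub ht)).mono hsub).continuousWithinAt
  have hint : IntervalIntegrable (fun s => G (x s) s) volume a b := by
    rw [intervalIntegrable_iff_integrableOn_Ioc_of_le hab]
    refine IntegrableOn.of_bound (by simp) ?_ B (Eventually.of_forall fun s => hB _ _)
    have hxm : AEMeasurable x (volume.restrict (Ioc a b)) :=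
      (hxc.mono Ioc_subset_Icc_self).aemeasurable measurableSet_Ioc
    exact (hG.comp_aemeasurable (hxm.prodMk aemeasurable_id)).aestronglyMeasurable
  refine ⟨hint, intervalIntegral.integral_eq_sub_of_hasDeriv_right_of_le hab hvc (fun t ht => ?_)
    hint⟩
  have := (h.deriv_snd t (hsub (Ioo_subset_Icc_self ht))).mono hsub
  exact (this.hasDerivAt (Icc_mem_nhds ht.1 ht.2)).hasDerivWithinAt

lemma intervalIntegrable_of_bound {F : E → ℝ → E} (hF : Measurable (Function.uncurry F))
    (hFB : ∀ y s, ‖F y s‖ ≤ B) (y : E) (a b : ℝ) : IntervalIntegrable (F y) volume a b := by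
  rw [intervalIntegrable_iff]
  refine IntegrableOn.of_bound (by simp) ?_ B (Eventually.of_forall fun s => hFB _ _)
  exact (hF.comp measurable_prodMk_left).aestronglyMeasurable

/-- The local error of a step of the splitting scheme. -/
lemma IsTrajectory.kickDrift_error (h : IsTrajectory G T x v)
    (hG : Measurable (Function.uncurry G)) (hB : ∀ y s, ‖G y s‖ ≤ B)
    {F : E → ℝ → E} (hF : Measurable (Function.uncurry F)) (hFB : ∀ y s, ‖F y s‖ ≤ B)
    {L δ : ℝ} (hL : 0 ≤ L) (hδ : ∀ y s, ‖G y s - F y s‖ ≤ δ)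
    (hLip : ∀ y y' s, ‖F y s - F y' s‖ ≤ L ^ 2 * ‖y - y'‖)
    {a b : ℝ} (ha : 0 ≤ a) (hab : a ≤ b) (hb : b ≤ T) (z : E × E) :
    L * ‖x b - (kickDrift F a b z).1‖ + ‖v b - (kickDrift F a b z).2‖ ≤
      (1 + (b - a) * L) ^ 2 * (L * ‖x a - z.1‖ + ‖v a - z.2‖) +
      (L * (B * (b - a) ^ 2) +
        (1 + (b - a) * L) * ((b - a) * (δ + L ^ 2 * ((b - a) * (‖v 0‖ + B * T))))) := by
  obtain ⟨hint, heq⟩ := h.integral_eq hG hB ha hab hb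
  have hFi := intervalIntegrable_of_bound hF hFB z.1 a b
  set d := b - a with hd
  have hd0 : 0 ≤ d := sub_nonneg.2 hab
  set W := ‖v 0‖ + B * T with hW
  have hW0 : 0 ≤ W := (norm_nonneg _).trans (h.norm_snd_le hB ⟨ha, hab.trans hb⟩)
  set I := ∫ s in a..b, F z.1 s with hI
  have hIb : ‖(v b - v a) - I‖ ≤ (δ + L ^ 2 * (‖x a - z.1‖ + d * W)) * d := by
    rw [← heq, hI, ← intervalIntegral.integral_sub hint hFi]
    have := intervalIntegral.norm_integral_le_of_norm_le_const (a := a) (b := b)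
      (f := fun s => G (x s) s - F z.1 s) (C := δ + L ^ 2 * (‖x a - z.1‖ + d * W)) ?_
    · rwa [abs_of_nonneg (sub_nonneg.2 hab)] at this
    · intro s hs
      rw [uIoc_of_le hab] at hs
      have h1 := hδ (x s) s
      have h2 := hLip (x s) z.1 s
      have h3 := h.norm_fst_sub_le hB ha hs.1.le (hs.2.trans hb)
      have h4 : ‖x s - z.1‖ ≤ ‖x a - z.1‖ + d * W := by
        have h5 : W * (s - a) ≤ d * W := by
          rw [mul_comm]; gcongr; linarith [hs.2]
        have h6 : ‖x s - z.1‖ ≤ ‖x s - x a‖ + ‖x a - z.1‖ := norm_sub_le_norm_sub_add_norm_sub ..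
        linarith
      have h7 : ‖G (x s) s - F z.1 s‖ ≤ ‖G (x s) s - F (x s) s‖ + ‖F (x s) s - F z.1 s‖ :=
        norm_sub_le_norm_sub_add_norm_sub ..
      have h8 := mul_le_mul_of_nonneg_left h4 (sq_nonneg L)
      linarith
  have hv : ‖v b - (z.2 + I)‖ ≤ ‖v a - z.2‖ + (δ + L ^ 2 * (‖x a - z.1‖ + d * W)) * d := by
    have : v b - (z.2 + I) = (v a - z.2) + ((v b - v a) - I) := by abel
    rw [this]
    exact (norm_add_le _ _).trans (by gcongr)
  have hx : ‖x b - (z.1 + d • (z.2 + I))‖ ≤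
      ‖x a - z.1‖ + d * ‖v b - (z.2 + I)‖ + B * d ^ 2 := by
    have : x b - (z.1 + d • (z.2 + I)) =
        (x a - z.1) + d • (v b - (z.2 + I)) + (x b - x a - d • v b) := by
      rw [smul_sub]; abel
    rw [this]
    refine (norm_add₃_le ..).trans ?_
    rw [norm_smul, Real.norm_of_nonneg hd0]
    gcongr
    exact h.norm_fst_sub_smul_le hB ha hab hb
  -- The weight `L` balances the system: the drift turns a velocity error into `d` times a position
  -- error, the kick turns a position error into `d * L ^ 2` times a velocity error, and in the
  -- weighted norm both factors become `d * L`.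
  change L * ‖x b - (z.1 + d • (z.2 + I))‖ + ‖v b - (z.2 + I)‖ ≤ _
  have e1 := mul_le_mul_of_nonneg_left hx hL
  have e2 := mul_le_mul_of_nonneg_left hv (by positivity : 0 ≤ 1 + d * L)
  -- These products are the slack between the true coefficients of the two initial errors, `L + (1 +
  -- d * L) * d * L ^ 2` and `1 + d * L`, and the coefficients given by the common factor `(1 + d *
  -- L) ^ 2`.
  have p1 : 0 ≤ d * L * ‖x a - z.1‖ * L := by positivity
  have p2 : 0 ≤ (d * L + (d * L) ^ 2) * ‖v a - z.2‖ := by positivity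
  nlinarith [e1, e2, p1, p2]

/-- The global error of the splitting scheme. -/
lemma IsTrajectory.splitting_error (h : IsTrajectory G T x v)
    (hG : Measurable (Function.uncurry G)) (hB : ∀ y s, ‖G y s‖ ≤ B)
    {F : E → ℝ → E} (hF : Measurable (Function.uncurry F)) (hFB : ∀ y s, ‖F y s‖ ≤ B)
    {L δ : ℝ} (hL : 0 ≤ L) (hδ : ∀ y s, ‖G y s - F y s‖ ≤ δ)
    (hLip : ∀ y y' s, ‖F y s - F y' s‖ ≤ L ^ 2 * ‖y - y'‖)
    {d : ℝ} (hd : 0 ≤ d) (n : ℕ) (hn : n * d ≤ T) :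
    L * ‖x (n * d) - (splitting F d n (x 0, v 0)).1‖ +
        ‖v (n * d) - (splitting F d n (x 0, v 0)).2‖ ≤
      ((1 + d * L) ^ 2) ^ n * (n * (L * (B * d ^ 2) +
        (1 + d * L) * (d * (δ + L ^ 2 * (d * (‖v 0‖ + B * T)))))) := by
  have hB0 : 0 ≤ B := (norm_nonneg _).trans (hB 0 0)
  have hδ0 : 0 ≤ δ := (norm_nonneg _).trans (hδ 0 0)
  have hT0 : 0 ≤ T := by refine le_trans ?_ hn; positivity
  induction n with
  | zero => simp [splitting]
  | succ n ih =>
    push_cast at hn ⊢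
    have hle : (n : ℝ) * d ≤ (n + 1) * d := by gcongr; linarith
    have hstep := h.kickDrift_error hG hB hF hFB hL hδ hLip (by positivity) hle hn
      (splitting F d n (x 0, v 0))
    have hdd : ((n : ℝ) + 1) * d - n * d = d := by ring
    rw [hdd] at hstep
    refine hstep.trans ?_
    set c := L * (B * d ^ 2) + (1 + d * L) * (d * (δ + L ^ 2 * (d * (‖v 0‖ + B * T)))) with hc
    have hc0 : 0 ≤ c := by positivity
    have hq : 1 ≤ (1 + d * L) ^ 2 := one_le_pow₀ (by nlinarith [mul_nonneg hd hL])
    have h1 := mul_le_mul_of_nonneg_left (ih (hle.trans hn)) (by positivity : 0 ≤ (1 + d * L) ^ 2)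
    have h2 : c ≤ ((1 + d * L) ^ 2) ^ (n + 1) * c := le_mul_of_one_le_left hc0 (one_le_pow₀ hq)
    calc _ ≤ (1 + d * L) ^ 2 * (((1 + d * L) ^ 2) ^ n * (n * c)) +
          ((1 + d * L) ^ 2) ^ (n + 1) * c := add_le_add h1 h2
      _ = _ := by ring

end bounded

/-! ### Passage to the limit and Liouville's theorem -/

/-- A uniformly proper pointwise limit of measure preserving maps is measure preserving. -/
lemma measurePreserving_of_tendsto {S : ℕ → E × E → E × E} {Φ : E × E → E × E}
    (hS : ∀ n, MeasurePreserving (S n) volume volume)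
    (hlim : ∀ z, Tendsto (fun n => S n z) atTop (𝓝 (Φ z)))
    (hprop : ∀ r : ℝ, ∃ r' : ℝ, ∀ n z, ‖S n z‖ ≤ r → ‖z‖ ≤ r') :
    MeasurePreserving Φ volume volume := by
  have hΦ : Measurable Φ :=
    measurable_of_tendsto_metrizable (fun n => (hS n).measurable) (tendsto_pi_nhds.2 hlim)
  refine ⟨hΦ, ?_⟩
  -- Properness puts the preimage of a compact set inside a ball. The image measure is thus locally
  -- finite, hence regular, and is determined by integrals of compactly supported continuous
  -- functions.
  have hfin : IsFiniteMeasureOnCompacts (Measure.map Φ (volume : Measure (E × E))) := by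
    refine ⟨fun K hK => ?_⟩
    obtain ⟨r, hr⟩ := hK.isBounded.exists_norm_le
    obtain ⟨r', hr'⟩ := hprop (r + 1)
    rw [Measure.map_apply hΦ hK.measurableSet]
    refine (measure_mono fun z hz => ?_).trans_lt
      (measure_closedBall_lt_top (x := (0 : E × E)) (r := r'))
    rw [mem_closedBall_zero_iff]
    have h1 : ∀ᶠ n in atTop, ‖S n z‖ < r + 1 :=
      (hlim z).norm.eventually_lt_const (by linarith [hr _ hz])
    obtain ⟨n, hn⟩ := h1.exists
    exact hr' n z hn.le
  have : (Measure.map Φ (volume : Measure (E × E))).Regular := inferInstance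
  refine Measure.ext_of_integral_eq_on_compactlySupported fun φ => ?_
  have hφ : Continuous (φ : E × E → ℝ) := φ.continuous
  rw [integral_map hΦ.aemeasurable hφ.aestronglyMeasurable]
  obtain ⟨r, hr⟩ := φ.hasCompactSupport.isCompact.isBounded.exists_norm_le
  obtain ⟨r', hr'⟩ := hprop r
  obtain ⟨c, hc⟩ := φ.hasCompactSupport.exists_bound_of_continuous hφ
  -- If `S n z` lies in the support of `φ`, then `z` lies in a ball independent of `n`; this
  -- supplies the dominating function.
  have hlim' : Tendsto (fun n => ∫ z, φ (S n z)) atTop (𝓝 (∫ z, φ (Φ z))) := by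
    refine tendsto_integral_of_dominated_convergence
      ((Metric.closedBall (0 : E × E) r').indicator fun _ => c) (fun n => ?_) ?_ (fun n => ?_) ?_
    · exact (hφ.measurable.comp (hS n).measurable).aestronglyMeasurable
    · exact (integrable_indicator_iff Metric.isClosed_closedBall.measurableSet).2
        (integrableOn_const (measure_closedBall_lt_top.ne))
    · refine Eventually.of_forall fun z => ?_
      by_cases hz : S n z ∈ tsupport φ
      · rw [indicator_of_mem (mem_closedBall_zero_iff.2 (hr' n z (hr _ hz)))]
        exact hc _
      · rw [image_eq_zero_of_notMem_tsupport hz, norm_zero]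
        exact indicator_nonneg (fun _ _ => (norm_nonneg _).trans (hc 0)) _
    · exact Eventually.of_forall fun z => (hφ.tendsto _).comp (hlim z)
  refine tendsto_nhds_unique hlim' (tendsto_const_nhds.congr fun n => ?_)
  conv_lhs => rw [← (hS n).map_eq]
  rw [integral_map (hS n).measurable.aemeasurable hφ.aestronglyMeasurable]

/-- This gives the uniform properness of the schemes: going backwards, a step changes the velocity
by at most `B * d` and the position by `d` times the velocity after the kick. -/
lemma splitting_proper {F : E → ℝ → E} {B d : ℝ} (hFB : ∀ y s, ‖F y s‖ ≤ B) (hd : 0 ≤ d)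
    (n : ℕ) (z : E × E) :
    ‖z.2‖ ≤ ‖(splitting F d n z).2‖ + B * (n * d) ∧
    ‖z.1‖ ≤ ‖(splitting F d n z).1‖ + n * d * (‖(splitting F d n z).2‖ + B * (n * d)) := by
  have hB0 : 0 ≤ B := (norm_nonneg _).trans (hFB 0 0)
  induction n with
  | zero => simp [splitting]
  | succ n ih =>
    obtain ⟨ih2, ih1⟩ := ih
    set y := splitting F d n z with hy
    have hs : splitting F d (n + 1) z = kickDrift F (n * d) ((n + 1) * d) y := rfl
    have hdd : ((n : ℝ) + 1) * d - n * d = d := by ring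
    set I := ∫ s in ((n : ℝ) * d)..((n + 1) * d), F y.1 s with hI
    have hIb : ‖I‖ ≤ B * d := by
      have := intervalIntegral.norm_integral_le_of_norm_le_const (a := (n : ℝ) * d)
        (b := (n + 1) * d) (f := fun s => F y.1 s) (C := B) (fun s _ => hFB _ _)
      rwa [hdd, abs_of_nonneg hd] at this
    have h2 : (splitting F d (n + 1) z).2 = y.2 + I := by rw [hs]; rfl
    have h1 : (splitting F d (n + 1) z).1 = y.1 + d • (y.2 + I) := by
      rw [hs, kickDrift, hdd]
    rw [h1, h2]
    push_cast
    have e2 : ‖y.2‖ ≤ ‖y.2 + I‖ + B * d := by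
      have := norm_sub_le (y.2 + I) I
      rw [add_sub_cancel_right] at this
      linarith
    have e1 : ‖y.1‖ ≤ ‖y.1 + d • (y.2 + I)‖ + d * ‖y.2 + I‖ := by
      have := norm_sub_le (y.1 + d • (y.2 + I)) (d • (y.2 + I))
      rwa [add_sub_cancel_right, norm_smul, Real.norm_of_nonneg hd] at this
    have hn : (0 : ℝ) ≤ n := n.cast_nonneg
    have e3 := mul_le_mul_of_nonneg_left e2 (mul_nonneg hn hd)
    have p1 : 0 ≤ d * (B * ((n + 1) * d)) := by positivity
    constructor
    · linarith
    · nlinarith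

/-- **Liouville's theorem** for the flow of `x' = v, v' = G x t`, where the bounded field `G`
is approximated by Lipschitz fields whose Lipschitz constants grow slowly. -/
theorem measurePreserving_flow {G : E → ℝ → E} (hG : Measurable (Function.uncurry G)) {B T : ℝ}
    (hB : ∀ y s, ‖G y s‖ ≤ B) (hT : 0 ≤ T)
    {F : ℕ → E → ℝ → E} (hF : ∀ n, Measurable (Function.uncurry (F n)))
    (hFB : ∀ n y s, ‖F n y s‖ ≤ B) {L δ : ℕ → ℝ} (hL : ∀ n, 1 ≤ L n)
    (hδ : ∀ n y s, ‖G y s - F n y s‖ ≤ δ n)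
    (hLip : ∀ n y y' s, ‖F n y s - F n y' s‖ ≤ L n ^ 2 * ‖y - y'‖)
    (hlim : Tendsto (fun n => Real.exp (2 * T * L n) * (L n ^ 3 / (n + 1) + L n * δ n))
      atTop (𝓝 0))
    {x v : E × E → ℝ → E} (hxv : ∀ z, IsTrajectory G T (x z) (v z))
    (h0 : ∀ z, (x z 0, v z 0) = z) :
    MeasurePreserving (fun z => (x z T, v z T)) volume volume := by
  have hB0 : 0 ≤ B := (norm_nonneg _).trans (hB 0 0)
  refine measurePreserving_of_tendsto (S := fun n => splitting (F n) (T / (n + 1)) (n + 1))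
    (fun n => measurePreserving_splitting (hF n) _ _) (fun z => ?_) (fun r => ?_)
  · set W := ‖v z 0‖ + B * T with hW
    have hW0 : 0 ≤ W := by positivity
    set M := T * (T * B + (1 + T) * (1 + T * W)) with hM
    have hM0 : 0 ≤ M := by positivity
    have hbound : ∀ n : ℕ, dist (splitting (F n) (T / (n + 1)) (n + 1) z) (x z T, v z T) ≤
        M * (Real.exp (2 * T * L n) * (L n ^ 3 / (n + 1) + L n * δ n)) := by
      intro n
      have hn : (0 : ℝ) < n + 1 := by positivity
      set d := T / (n + 1) with hd
      have hd0 : 0 ≤ d := by positivity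
      have hnd : ((n + 1 : ℕ) : ℝ) * d = T := by push_cast; rw [hd]; field_simp
      have hL1 := hL n
      have hL0 : 0 ≤ L n := by linarith
      have hδ0 : 0 ≤ δ n := (norm_nonneg _).trans (hδ n 0 0)
      have key := (hxv z).splitting_error hG hB (hF n) (hFB n) hL0 (hδ n) (hLip n) hd0 (n + 1)
        hnd.le
      rw [hnd, h0 z] at key
      have hexp : ((1 + d * L n) ^ 2) ^ (n + 1) ≤ Real.exp (2 * T * L n) := by
        have h1 : 1 + d * L n ≤ Real.exp (d * L n) := by
          linarith [Real.add_one_le_exp (d * L n)]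
        calc ((1 + d * L n) ^ 2) ^ (n + 1) ≤ (Real.exp (d * L n) ^ 2) ^ (n + 1) := by gcongr
          _ = Real.exp (2 * T * L n) := by
            rw [← Real.exp_nat_mul, ← Real.exp_nat_mul, ← hnd]
            congr 1
            push_cast; ring
      have hc : ((n + 1 : ℕ) : ℝ) * (L n * (B * d ^ 2) +
          (1 + d * L n) * (d * (δ n + L n ^ 2 * (d * W)))) ≤
          M * (L n ^ 3 / (n + 1) + L n * δ n) := by
        have hdT : d ≤ T := div_le_self hT (by linarith [(Nat.cast_nonneg n : (0:ℝ) ≤ n)])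
        have hd' : d = T * (1 / (n + 1)) := by rw [hd]; ring
        set u : ℝ := 1 / (n + 1) with hu
        have hu0 : 0 ≤ u := by positivity
        have e1 : ((n + 1 : ℕ) : ℝ) * (L n * (B * d ^ 2) +
          (1 + d * L n) * (d * (δ n + L n ^ 2 * (d * W)))) =
          T * (L n * (B * d) + (1 + d * L n) * (δ n + L n ^ 2 * (d * W))) := by
          rw [← hnd]; ring
        have e2 : L n ^ 3 / (n + 1) = L n ^ 3 * u := by rw [hu]; ring
        rw [e1, e2, hM, mul_assoc]
        refine mul_le_mul_of_nonneg_left ?_ hT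
        -- `1 ≤ L n` and `d ≤ T` raise all lower powers of `L n` to the two terms `L n ^ 3 * u` and
        -- `L n * δ n`.
        have f1 : L n * (B * d) ≤ T * B * (L n ^ 3 * u) := by
          rw [hd']
          have : L n ≤ L n ^ 3 := le_self_pow₀ hL1 (by norm_num)
          have := mul_le_mul_of_nonneg_right this (by positivity : 0 ≤ T * B * u)
          linarith
        have f2 : 1 + d * L n ≤ (1 + T) * L n := by nlinarith
        have f3 : (1 + d * L n) * (δ n + L n ^ 2 * (d * W)) ≤
            (1 + T) * L n * (δ n + L n ^ 2 * (T * u * W)) := by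
          rw [hd'] at f2 ⊢
          gcongr
        have g1 : 0 ≤ L n ^ 3 * u := by positivity
        have g2 : 0 ≤ L n * δ n := by positivity
        have g3 : 0 ≤ T * B * (L n * δ n) := by positivity
        have g4 : 0 ≤ (1 + T) * (L n ^ 3 * u) := by positivity
        have g5 : 0 ≤ (1 + T) * (T * W) * (L n * δ n) := by positivity
        nlinarith
      have hdist : dist (splitting (F n) d (n + 1) z) (x z T, v z T) ≤
          L n * ‖x z T - (splitting (F n) d (n + 1) z).1‖ +
          ‖v z T - (splitting (F n) d (n + 1) z).2‖ := by
        rw [dist_comm, dist_eq_norm, Prod.norm_def]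
        refine max_le ?_ ?_
        · have := le_mul_of_one_le_left (norm_nonneg (x z T - (splitting (F n) d (n + 1) z).1)) hL1
          exact this.trans (le_add_of_nonneg_right (norm_nonneg _))
        · exact le_add_of_nonneg_left (by positivity)
      refine hdist.trans (key.trans ?_)
      calc _ ≤ Real.exp (2 * T * L n) * (M * (L n ^ 3 / (n + 1) + L n * δ n)) := by
            refine mul_le_mul hexp hc ?_ (Real.exp_pos _).le
            positivity
        _ = _ := by ring
    refine tendsto_iff_dist_tendsto_zero.2 (squeeze_zero (fun _ => dist_nonneg) hbound ?_)
    simpa using hlim.const_mul M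
  -- The radius dominates both the velocity bound `r + B * T` and the position bound `r + T * (r + B
  -- * T)`.
  · refine ⟨r + (T + 1) * (r + B * T), fun n z hz => ?_⟩
    have hd0 : 0 ≤ T / ((n : ℝ) + 1) := by positivity
    have hnd : ((n + 1 : ℕ) : ℝ) * (T / (n + 1)) = T := by push_cast; field_simp
    obtain ⟨h2, h1⟩ := splitting_proper (hFB n) hd0 (n + 1) z
    rw [hnd] at h1 h2
    have a1 := (norm_fst_le _).trans hz
    have a2 := (norm_snd_le _).trans hz
    have hr0 : 0 ≤ r := (norm_nonneg _).trans hz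
    have hBT : 0 ≤ B * T := by positivity
    rw [Prod.norm_def]
    have a3 := mul_le_mul_of_nonneg_left a2 hT
    refine max_le ?_ ?_
    · nlinarith
    · nlinarith [mul_nonneg hT (add_nonneg hr0 hBT)]

/-! ### The softened Newton kernel -/

/-- The softened distance `√(|a|² + ε²)`. -/
noncomputable def soft (ε : ℝ) (a : E) : ℝ := √(‖a‖ ^ 2 + ε ^ 2)

/-- The softened Newton kernel `a / (|a|² + ε²)^{3/2}`. -/
noncomputable def softKernel (ε : ℝ) (a : E) : E := ((soft ε a) ^ 3)⁻¹ • a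

/-- The weight `1 / (|a|² √(|a|² + ε²))` controlling the softening error. -/
noncomputable def softWeight (ε : ℝ) (a : E) : ℝ := (‖a‖ ^ 2 * soft ε a)⁻¹

lemma soft_nonneg (ε : ℝ) (a : E) : 0 ≤ soft ε a := Real.sqrt_nonneg _

lemma soft_sq (ε : ℝ) (a : E) : soft ε a ^ 2 = ‖a‖ ^ 2 + ε ^ 2 := Real.sq_sqrt (by positivity)

@[simp] lemma soft_zero_left (a : E) : soft 0 a = ‖a‖ := by
  simp [soft, Real.sqrt_sq (norm_nonneg a)]

@[simp] lemma soft_neg (ε : ℝ) (a : E) : soft ε (-a) = soft ε a := by simp [soft]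

lemma norm_le_soft (ε : ℝ) (a : E) : ‖a‖ ≤ soft ε a :=
  Real.le_sqrt_of_sq_le (by nlinarith [sq_nonneg ε])

lemma le_soft {ε : ℝ} (a : E) : ε ≤ soft ε a :=
  Real.le_sqrt_of_sq_le (by nlinarith [sq_nonneg ‖a‖])

lemma soft_pos {ε : ℝ} (hε : 0 < ε) (a : E) : 0 < soft ε a := hε.trans_le (le_soft a)

lemma soft_le {ε : ℝ} (hε : 0 ≤ ε) (a : E) : soft ε a ≤ ‖a‖ + ε := by
  have := norm_nonneg a
  exact Real.sqrt_le_iff.2 ⟨by positivity, by nlinarith⟩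

lemma continuous_soft (ε : ℝ) : Continuous (soft ε) := by
  unfold soft; fun_prop

/-- `soft ε a` is the norm of `(a, ε)` in four dimensions, hence 1-Lipschitz in `a`; the proof
divides a difference of squares by the sum. -/
lemma abs_soft_sub_le {ε : ℝ} (hε : 0 < ε) (a b : E) : |soft ε a - soft ε b| ≤ ‖a - b‖ := by
  have ha := soft_pos hε a
  have hb := soft_pos hε b
  have h1 : (soft ε a - soft ε b) * (soft ε a + soft ε b) = (‖a‖ - ‖b‖) * (‖a‖ + ‖b‖) := by
    linear_combination soft_sq ε a - soft_sq ε b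
  have h2 : |soft ε a - soft ε b| * (soft ε a + soft ε b) ≤
      ‖a - b‖ * (soft ε a + soft ε b) := by
    calc |soft ε a - soft ε b| * (soft ε a + soft ε b)
        = |(soft ε a - soft ε b) * (soft ε a + soft ε b)| := by
          rw [abs_mul, abs_of_pos (add_pos ha hb)]
      _ = |‖a‖ - ‖b‖| * (‖a‖ + ‖b‖) := by rw [h1, abs_mul, abs_of_nonneg (a := ‖a‖ + ‖b‖)
            (by positivity)]
      _ ≤ ‖a - b‖ * (soft ε a + soft ε b) := by
          gcongr
          · exact abs_norm_sub_norm_le a b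
          · exact norm_le_soft ε a
          · exact norm_le_soft ε b
  exact le_of_mul_le_mul_right h2 (add_pos ha hb)

lemma norm_softKernel_le (ε : ℝ) (a : E) : ‖softKernel ε a‖ ≤ (‖a‖ ^ 2)⁻¹ := by
  rcases eq_or_ne a 0 with rfl | ha
  · simp [softKernel]
  have h0 : 0 < ‖a‖ := norm_pos_iff.2 ha
  rw [softKernel, norm_smul, norm_inv, norm_pow, Real.norm_of_nonneg (soft_nonneg _ _)]
  have h1 : ‖a‖ ^ 3 ≤ soft ε a ^ 3 := by gcongr; exact norm_le_soft ε a
  calc (soft ε a ^ 3)⁻¹ * ‖a‖ ≤ (‖a‖ ^ 3)⁻¹ * ‖a‖ := by gcongr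
    _ = (‖a‖ ^ 2)⁻¹ := by field_simp

lemma softKernel_neg (ε : ℝ) (a : E) : softKernel ε (-a) = -softKernel ε a := by
  simp [softKernel]

lemma measurable_softKernel (ε : ℝ) : Measurable (softKernel ε) :=
  ((continuous_soft ε).measurable.pow_const 3).inv.smul measurable_id

lemma measurable_softWeight (ε : ℝ) : Measurable (softWeight ε) :=
  ((measurable_norm.pow_const 2).mul (continuous_soft ε).measurable).inv

lemma softWeight_nonneg (ε : ℝ) (a : E) : 0 ≤ softWeight ε a := by
  have := soft_nonneg ε a
  unfold softWeight; positivity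

/-- Bounding by the values at both endpoints avoids any estimate along the segment from `a` to `b`,
which may pass near the origin. -/
lemma norm_softKernel_sub_softKernel_le {ε : ℝ} (hε : 0 < ε) (a b : E) :
    ‖softKernel ε a - softKernel ε b‖ ≤
      4 * ‖a - b‖ * ((soft ε a ^ 3)⁻¹ + (soft ε b ^ 3)⁻¹) := by
  have ha := soft_pos hε a
  have hb := soft_pos hε b
  have hd := abs_soft_sub_le hε a b
  have hnb := norm_le_soft ε b
  unfold softKernel
  rw [← inv_pow, ← inv_pow]
  set s := soft ε a
  set t := soft ε b
  set p := s⁻¹ with hp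
  set q := t⁻¹ with hq
  have hp0 : 0 < p := inv_pos.2 ha
  have hq0 : 0 < q := inv_pos.2 hb
  have hpq : p - q = p * q * (t - s) := by
    rw [hp, hq]; field_simp
  have hbq : ‖b‖ * q ≤ 1 := by
    rw [hq]; exact mul_inv_le_one_of_le₀ hnb hb.le
  have h1 : p ^ 3 • a - q ^ 3 • b = p ^ 3 • (a - b) + (p ^ 3 - q ^ 3) • b := by
    rw [smul_sub, sub_smul]; abel
  have h2 : ‖(p ^ 3 - q ^ 3) • b‖ ≤ p * (p ^ 2 + p * q + q ^ 2) * ‖a - b‖ := by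
    have : p ^ 3 - q ^ 3 = p * q * (p ^ 2 + p * q + q ^ 2) * (t - s) := by
      linear_combination (p ^ 2 + p * q + q ^ 2) * hpq
    rw [this, norm_smul, Real.norm_eq_abs, abs_mul, abs_of_pos (by positivity), abs_sub_comm]
    calc p * q * (p ^ 2 + p * q + q ^ 2) * |s - t| * ‖b‖
        = (p * (p ^ 2 + p * q + q ^ 2) * |s - t|) * (‖b‖ * q) := by ring
      _ ≤ (p * (p ^ 2 + p * q + q ^ 2) * |s - t|) * 1 := by gcongr
      _ ≤ p * (p ^ 2 + p * q + q ^ 2) * ‖a - b‖ := by rw [mul_one]; gcongr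
  have h3 : ‖p ^ 3 • (a - b)‖ = p ^ 3 * ‖a - b‖ := by
    rw [norm_smul, Real.norm_of_nonneg (by positivity)]
  rw [h1]
  refine (norm_add_le _ _).trans ?_
  rw [h3]
  -- This follows from `p ^ 2 * q + p * q ^ 2 ≤ p ^ 3 + q ^ 3`, that is `(p + q) * (p - q) ^ 2 ≥ 0`.
  have h4 : p ^ 3 + p * (p ^ 2 + p * q + q ^ 2) ≤ 4 * (p ^ 3 + q ^ 3) := by
    nlinarith [mul_nonneg (add_pos hp0 hq0).le (sq_nonneg (p - q)), pow_pos hp0 3, pow_pos hq0 3]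
  have := mul_le_mul_of_nonneg_right h4 (norm_nonneg (a - b))
  linarith

/-- Softening lengthens the distance by at most `ε`, so the difference of cubes yields a factor `ε`.
The weight that remains has only a logarithmically large integral over the unit ball. -/
lemma norm_softKernel_zero_sub_le {ε : ℝ} (hε : 0 < ε) (a : E) :
    ‖softKernel 0 a - softKernel ε a‖ ≤ 3 * ε * softWeight ε a := by
  rcases eq_or_ne a 0 with rfl | ha
  · simp [softKernel, softWeight]
  have hr : 0 < ‖a‖ := norm_pos_iff.2 ha
  have hs := soft_pos hε a
  have hrs := norm_le_soft ε a
  have hsr := soft_le hε.le a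
  rw [softKernel, softKernel, soft_zero_left, ← sub_smul, norm_smul, softWeight, Real.norm_eq_abs]
  set s := soft ε a
  set r := ‖a‖
  have h1 : (r ^ 3)⁻¹ - (s ^ 3)⁻¹ = (s ^ 3 - r ^ 3) / (r ^ 3 * s ^ 3) := by field_simp
  have h2 : 0 ≤ s ^ 3 - r ^ 3 := sub_nonneg.2 (by gcongr)
  have h3 : s ^ 3 - r ^ 3 ≤ 3 * ε * s ^ 2 := by
    have : s ^ 3 - r ^ 3 = (s - r) * (s ^ 2 + s * r + r ^ 2) := by ring
    rw [this]
    have h4 : s ^ 2 + s * r + r ^ 2 ≤ 3 * s ^ 2 := by nlinarith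
    calc (s - r) * (s ^ 2 + s * r + r ^ 2) ≤ ε * (3 * s ^ 2) := by
          gcongr
          linarith
      _ = 3 * ε * s ^ 2 := by ring
  rw [h1, abs_of_nonneg (by positivity)]
  calc (s ^ 3 - r ^ 3) / (r ^ 3 * s ^ 3) * r ≤ (3 * ε * s ^ 2) / (r ^ 3 * s ^ 3) * r := by gcongr
    _ = 3 * ε * (r ^ 2 * s)⁻¹ := by field_simp

/-- The same weight thus controls the Lipschitz constant of the softened field. The origin is
excluded because `softWeight ε 0 = 0` by the convention for inverses. -/
lemma inv_soft_cube_le {ε : ℝ} {a : E} (ha : a ≠ 0) : (soft ε a ^ 3)⁻¹ ≤ softWeight ε a := by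
  have hr : 0 < ‖a‖ := norm_pos_iff.2 ha
  have hrs := norm_le_soft ε a
  have hs : 0 < soft ε a := hr.trans_le hrs
  unfold softWeight
  rw [pow_succ]
  gcongr

/-! ### Radial integrals -/

lemma finrank_E : Module.finrank ℝ E = 3 := by simp [E]

lemma integrableOn_ball_norm {f : ℝ → ℝ} {r : ℝ}
    (hf : IntegrableOn (fun y => y ^ 2 * f y) (Ioo 0 r)) :
    IntegrableOn (fun a : E => f ‖a‖) (Metric.ball 0 r) := by
  rw [integrableOn_fun_norm_addHaar, finrank_E]
  simpa using hf

lemma setIntegral_ball_norm (f : ℝ → ℝ) (r : ℝ) :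
    ∫ a in Metric.ball (0 : E) r, f ‖a‖ =
      3 * volume.real (Metric.ball (0 : E) 1) * ∫ y in Ioo 0 r, y ^ 2 * f y := by
  have h1 : ∫ a in Metric.ball (0 : E) r, f ‖a‖ =
      ∫ a : E, (Iio r).indicator f ‖a‖ := by
    rw [← integral_indicator Metric.isOpen_ball.measurableSet]
    congr 1; ext a; simp [indicator]
  rw [h1, integral_fun_norm_addHaar, finrank_E, nsmul_eq_mul, smul_eq_mul, ← mul_assoc]
  congr 1
  rw [← integral_indicator measurableSet_Ioi, ← integral_indicator measurableSet_Ioo]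
  congr 1; ext y
  by_cases h0 : 0 < y <;> by_cases h1 : y < r <;> simp [indicator, h0, h1]

/-- The volume of the unit ball. -/
noncomputable def unitVol : ℝ := volume.real (Metric.ball (0 : E) 1)

lemma unitVol_nonneg : 0 ≤ unitVol := measureReal_nonneg

/-- The Jacobian `y ^ 2` leaves `1 / √(y ^ 2 + ε ^ 2) ≤ 2 / (y + ε)`, which integrates to a
logarithm. -/
lemma integrableOn_softWeight_aux {ε : ℝ} (hε : 0 < ε) :
    IntegrableOn (fun y : ℝ => y ^ 2 * (y ^ 2 * √(y ^ 2 + ε ^ 2))⁻¹) (Ioo 0 1) ∧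
    ∫ y in Ioo (0 : ℝ) 1, y ^ 2 * (y ^ 2 * √(y ^ 2 + ε ^ 2))⁻¹ ≤ 2 * Real.log (1 + ε⁻¹) := by
  have hb : ∀ y ∈ Ioo (0 : ℝ) 1, y ^ 2 * (y ^ 2 * √(y ^ 2 + ε ^ 2))⁻¹ ≤ 2 * (y + ε)⁻¹ := by
    intro y hy
    have h0 := hy.1
    have h1 : y + ε ≤ 2 * √(y ^ 2 + ε ^ 2) := by
      have a1 : y ≤ √(y ^ 2 + ε ^ 2) := Real.le_sqrt_of_sq_le (by nlinarith)
      have a2 : ε ≤ √(y ^ 2 + ε ^ 2) := Real.le_sqrt_of_sq_le (by nlinarith)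
      linarith
    have h2 : 0 < √(y ^ 2 + ε ^ 2) := by positivity
    have h3 : y ^ 2 * (y ^ 2 * √(y ^ 2 + ε ^ 2))⁻¹ = (√(y ^ 2 + ε ^ 2))⁻¹ := by field_simp
    rw [h3, ← div_eq_mul_inv, inv_eq_one_div, div_le_div_iff₀ h2 (by positivity)]
    linarith
  have hcont : ContinuousOn (fun y : ℝ => 2 * (y + ε)⁻¹) (Icc 0 1) := by
    refine continuousOn_const.mul (ContinuousOn.inv₀ (by fun_prop) fun y hy => ?_)
    linarith [hy.1]
  have hint : IntegrableOn (fun y : ℝ => 2 * (y + ε)⁻¹) (Ioo 0 1) :=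
    (hcont.integrableOn_Icc).mono_set Ioo_subset_Icc_self
  have hI : IntegrableOn (fun y : ℝ => y ^ 2 * (y ^ 2 * √(y ^ 2 + ε ^ 2))⁻¹) (Ioo 0 1) := by
    refine Integrable.mono' hint (Measurable.aestronglyMeasurable (by fun_prop)) ?_
    refine (ae_restrict_iff' measurableSet_Ioo).2 (Eventually.of_forall fun y hy => ?_)
    rw [Real.norm_of_nonneg (by positivity)]
    exact hb y hy
  refine ⟨hI, (setIntegral_mono_on hI hint measurableSet_Ioo hb).trans (le_of_eq ?_)⟩
  rw [← integral_Ioc_eq_integral_Ioo, ← intervalIntegral.integral_of_le zero_le_one,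
    intervalIntegral.integral_const_mul,
    intervalIntegral.integral_comp_add_right (fun y => y⁻¹) ε, integral_inv_of_pos (by simpa)
    (by positivity)]
  congr 2
  field_simp; ring

lemma integrableOn_softWeight {ε : ℝ} (hε : 0 < ε) :
    IntegrableOn (softWeight ε) (Metric.ball 0 1) ∧
    ∫ a in Metric.ball (0 : E) 1, softWeight ε a ≤ 6 * unitVol * Real.log (1 + ε⁻¹) := by
  obtain ⟨h1, h2⟩ := integrableOn_softWeight_aux hε
  refine ⟨integrableOn_ball_norm (f := fun y => (y ^ 2 * √(y ^ 2 + ε ^ 2))⁻¹) h1, ?_⟩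
  have := setIntegral_ball_norm (fun y => (y ^ 2 * √(y ^ 2 + ε ^ 2))⁻¹) 1
  change ∫ a in Metric.ball (0 : E) 1, (‖a‖ ^ 2 * √(‖a‖ ^ 2 + ε ^ 2))⁻¹ ≤ _
  rw [this]
  have := mul_le_mul_of_nonneg_left h2 (mul_nonneg (by norm_num : (0:ℝ) ≤ 3) unitVol_nonneg)
  unfold unitVol at *
  linarith

lemma integrableOn_norm_sq_inv : IntegrableOn (fun a : E => (‖a‖ ^ 2)⁻¹) (Metric.ball 0 1) := by
  refine integrableOn_ball_norm (f := fun y => (y ^ 2)⁻¹) ?_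
  refine IntegrableOn.congr_fun (f := fun _ => (1 : ℝ)) (integrableOn_const (by simp))
    (fun y hy => ?_) measurableSet_Ioo
  have := hy.1
  simp only; field_simp

lemma softWeight_le_one {ε : ℝ} {a : E} (ha : a ∉ Metric.ball (0 : E) 1) : softWeight ε a ≤ 1 := by
  have h : 1 ≤ ‖a‖ := by simpa using ha
  exact inv_le_one_of_one_le₀ (one_le_mul_of_one_le_of_one_le (one_le_pow₀ h)
    (h.trans (norm_le_soft ε a)))

lemma norm_sq_inv_le_one {a : E} (ha : a ∉ Metric.ball (0 : E) 1) : (‖a‖ ^ 2)⁻¹ ≤ 1 := by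
  have h : 1 ≤ ‖a‖ := by simpa using ha
  exact inv_le_one_of_one_le₀ (one_le_pow₀ h)

/-! ### Fields of bounded, compactly supported densities -/

/-- A measurable density with values in `[0, c]` that vanishes off the ball of radius `R`. -/
structure IsBoundedDensity (c R : ℝ) (ρ : E → ℝ) : Prop where
  measurable : Measurable ρ
  nonneg : ∀ y, 0 ≤ ρ y
  le : ∀ y, ρ y ≤ c
  eq_zero : ∀ y, R < ‖y‖ → ρ y = 0

/-- Mass of a density of size one on the ball of radius `R`, seen through a kernel of mass `m` on
the unit ball and size one off it. -/
noncomputable def convBound (R m : ℝ) : ℝ := m + volume.real (Metric.closedBall (0 : E) R)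

/-- Split at distance one: near `x` the density is at most `c` and the kernel is integrable; away
from `x` the kernel is at most one and the density lives on a ball. The bound is uniform in `x`. -/
lemma IsBoundedDensity.integrable_mul {c R : ℝ} {ρ : E → ℝ} (hρ : IsBoundedDensity c R ρ)
    {k : E → ℝ} (hk : Measurable k) (hk0 : ∀ a, 0 ≤ k a)
    (hk1 : ∀ a, a ∉ Metric.ball (0 : E) 1 → k a ≤ 1)
    (hki : IntegrableOn k (Metric.ball 0 1)) (x : E) :
    Integrable (fun y => ρ y * k (x - y)) ∧
    ∫ y, ρ y * k (x - y) ≤ c * convBound R (∫ a in Metric.ball (0 : E) 1, k a) := by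
  have hc : 0 ≤ c := (hρ.nonneg 0).trans (hρ.le 0)
  have hi1 : Integrable ((Metric.ball (0 : E) 1).indicator k) :=
    (integrable_indicator_iff Metric.isOpen_ball.measurableSet).2 hki
  have hi2 : Integrable ((Metric.closedBall (0 : E) R).indicator fun _ => (1 : ℝ)) :=
    (integrable_indicator_iff Metric.isClosed_closedBall.measurableSet).2
      (integrableOn_const measure_closedBall_lt_top.ne)
  have hi : Integrable fun y => c * ((Metric.ball (0 : E) 1).indicator k (x - y) +
      (Metric.closedBall (0 : E) R).indicator (fun _ => (1 : ℝ)) y) :=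
    ((hi1.comp_sub_left x).add hi2).const_mul c
  have hle : ∀ y, ρ y * k (x - y) ≤ c * ((Metric.ball (0 : E) 1).indicator k (x - y) +
      (Metric.closedBall (0 : E) R).indicator (fun _ => (1 : ℝ)) y) := by
    intro y
    have p1 : 0 ≤ (Metric.ball (0 : E) 1).indicator k (x - y) :=
      indicator_nonneg (fun a _ => hk0 a) _
    have p2 : 0 ≤ (Metric.closedBall (0 : E) R).indicator (fun _ => (1 : ℝ)) y :=
      indicator_nonneg (fun _ _ => zero_le_one) _
    by_cases hy : R < ‖y‖
    · rw [hρ.eq_zero y hy, zero_mul]; positivity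
    · have hy' : y ∈ Metric.closedBall (0 : E) R := by simpa using hy
      refine mul_le_mul (hρ.le y) ?_ (hk0 _) hc
      rw [indicator_of_mem hy']
      by_cases hx : x - y ∈ Metric.ball (0 : E) 1
      · rw [indicator_of_mem hx]; linarith
      · linarith [hk1 _ hx]
  have hint : Integrable fun y => ρ y * k (x - y) := by
    refine hi.mono' ?_ (Eventually.of_forall fun y => ?_)
    · exact (hρ.measurable.mul (hk.comp (measurable_const.sub measurable_id))).aestronglyMeasurable
    · rw [Real.norm_of_nonneg (mul_nonneg (hρ.nonneg _) (hk0 _))]; exact hle y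
  refine ⟨hint, (integral_mono hint hi hle).trans (le_of_eq ?_)⟩
  rw [integral_const_mul, integral_add (hi1.comp_sub_left x) hi2,
    integral_sub_left_eq_self (fun y => (Metric.ball (0 : E) 1).indicator k y) volume x,
    integral_indicator Metric.isOpen_ball.measurableSet,
    integral_indicator_const _ Metric.isClosed_closedBall.measurableSet]
  simp [convBound]

/-- The gravitational field of the density `ρ` with softening `ε`. -/
noncomputable def softField (ε : ℝ) (ρ : E → ℝ) (x : E) : E := -∫ y, ρ y • softKernel ε (x - y)

section fields

variable {c R : ℝ} {ρ : E → ℝ}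

lemma IsBoundedDensity.integrable_norm_sq_inv (hρ : IsBoundedDensity c R ρ) (x : E) :
    Integrable (fun y => ρ y * (‖x - y‖ ^ 2)⁻¹) ∧
    ∫ y, ρ y * (‖x - y‖ ^ 2)⁻¹ ≤
      c * convBound R (∫ a in Metric.ball (0 : E) 1, (‖a‖ ^ 2)⁻¹) :=
  hρ.integrable_mul (k := fun a => (‖a‖ ^ 2)⁻¹) (by fun_prop) (fun a => by positivity)
    (fun a ha => norm_sq_inv_le_one ha) integrableOn_norm_sq_inv x

lemma IsBoundedDensity.integrable_softWeight (hρ : IsBoundedDensity c R ρ) {ε : ℝ} (hε : 0 < ε)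
    (x : E) :
    Integrable (fun y => ρ y * softWeight ε (x - y)) ∧
    ∫ y, ρ y * softWeight ε (x - y) ≤
      c * convBound R (6 * unitVol * Real.log (1 + ε⁻¹)) := by
  obtain ⟨h1, h2⟩ := integrableOn_softWeight hε
  obtain ⟨h3, h4⟩ := hρ.integrable_mul (measurable_softWeight ε) (softWeight_nonneg ε)
    (fun a ha => softWeight_le_one ha) h1 x
  refine ⟨h3, h4.trans ?_⟩
  have hc : 0 ≤ c := (hρ.nonneg 0).trans (hρ.le 0)
  unfold convBound
  gcongr

lemma IsBoundedDensity.integrable_softKernel (hρ : IsBoundedDensity c R ρ) (ε : ℝ) (x : E) :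
    Integrable (fun y => ρ y • softKernel ε (x - y)) := by
  refine (hρ.integrable_norm_sq_inv x).1.mono' ?_ (Eventually.of_forall fun y => ?_)
  · exact (hρ.measurable.smul ((measurable_softKernel ε).comp
      (measurable_const.sub measurable_id))).aestronglyMeasurable
  · rw [norm_smul, Real.norm_of_nonneg (hρ.nonneg y)]
    exact mul_le_mul_of_nonneg_left (norm_softKernel_le ε _) (hρ.nonneg y)

lemma IsBoundedDensity.norm_softField_le (hρ : IsBoundedDensity c R ρ) (ε : ℝ) (x : E) :
    ‖softField ε ρ x‖ ≤ c * convBound R (∫ a in Metric.ball (0 : E) 1, (‖a‖ ^ 2)⁻¹) := by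
  obtain ⟨h1, h2⟩ := hρ.integrable_norm_sq_inv x
  rw [softField, norm_neg]
  refine (norm_integral_le_of_norm_le h1 (Eventually.of_forall fun y => ?_)).trans h2
  rw [norm_smul, Real.norm_of_nonneg (hρ.nonneg y)]
  exact mul_le_mul_of_nonneg_left (norm_softKernel_le ε _) (hρ.nonneg y)

lemma IsBoundedDensity.norm_softField_zero_sub_le (hρ : IsBoundedDensity c R ρ) {ε : ℝ}
    (hε : 0 < ε) (x : E) : ‖softField 0 ρ x - softField ε ρ x‖ ≤
      3 * ε * (c * convBound R (6 * unitVol * Real.log (1 + ε⁻¹))) := by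
  obtain ⟨h1, h2⟩ := hρ.integrable_softWeight hε x
  have e : softField 0 ρ x - softField ε ρ x =
      -∫ y, ρ y • (softKernel 0 (x - y) - softKernel ε (x - y)) := by
    simp only [smul_sub]
    rw [integral_sub (hρ.integrable_softKernel 0 x) (hρ.integrable_softKernel ε x), softField,
      softField]
    abel
  rw [e, norm_neg]
  refine (norm_integral_le_of_norm_le (h1.const_mul (3 * ε)) (Eventually.of_forall
    fun y => ?_)).trans ?_
  · rw [norm_smul, Real.norm_of_nonneg (hρ.nonneg y)]
    have := mul_le_mul_of_nonneg_left (norm_softKernel_zero_sub_le hε (x - y)) (hρ.nonneg y)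
    linarith
  · rw [integral_const_mul]; gcongr

lemma IsBoundedDensity.norm_softField_sub_le (hρ : IsBoundedDensity c R ρ) {ε : ℝ}
    (hε : 0 < ε) (x x' : E) : ‖softField ε ρ x - softField ε ρ x'‖ ≤
      8 * (c * convBound R (6 * unitVol * Real.log (1 + ε⁻¹))) * ‖x - x'‖ := by
  obtain ⟨h1, h2⟩ := hρ.integrable_softWeight hε x
  obtain ⟨h1', h2'⟩ := hρ.integrable_softWeight hε x'
  have e : softField ε ρ x - softField ε ρ x' =
      -∫ y, ρ y • (softKernel ε (x - y) - softKernel ε (x' - y)) := by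
    simp only [smul_sub]
    rw [integral_sub (hρ.integrable_softKernel ε x) (hρ.integrable_softKernel ε x'), softField,
      softField]
    abel
  rw [e, norm_neg]
  refine (norm_integral_le_of_norm_le ((h1.add h1').const_mul (4 * ‖x - x'‖)) ?_).trans ?_
  · have n1 : ∀ᵐ y : E, y ≠ x := by simp [ae_iff]
    have n2 : ∀ᵐ y : E, y ≠ x' := by simp [ae_iff]
    filter_upwards [n1, n2] with y hy hy'
    have k := norm_softKernel_sub_softKernel_le hε (x - y) (x' - y)
    rw [sub_sub_sub_cancel_right] at k
    have k1 := inv_soft_cube_le (ε := ε) (sub_ne_zero.2 hy.symm)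
    have k2 := inv_soft_cube_le (ε := ε) (sub_ne_zero.2 hy'.symm)
    rw [norm_smul, Real.norm_of_nonneg (hρ.nonneg y)]
    calc ρ y * ‖softKernel ε (x - y) - softKernel ε (x' - y)‖
        ≤ ρ y * (4 * ‖x - x'‖ * (softWeight ε (x - y) + softWeight ε (x' - y))) := by
          refine mul_le_mul_of_nonneg_left (k.trans ?_) (hρ.nonneg y)
          gcongr
      _ = _ := by simp only [Pi.add_apply]; ring
  · rw [integral_const_mul]
    simp only [Pi.add_apply]
    rw [integral_add h1 h1']
    have := mul_le_mul_of_nonneg_left (add_le_add h2 h2')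
      (by positivity : 0 ≤ 4 * ‖x - x'‖)
    linarith

end fields

lemma measurable_softField {ρ : ℝ → E → ℝ} (hρ : Measurable (Function.uncurry ρ)) (ε : ℝ) :
    Measurable (Function.uncurry fun x t => softField ε (ρ t) x) := by
  have : StronglyMeasurable fun p : (E × ℝ) × E => ρ p.1.2 p.2 • softKernel ε (p.1.1 - p.2) := by
    have h1 : Measurable fun p : (E × ℝ) × E => ρ p.1.2 p.2 :=
      hρ.comp ((measurable_snd.comp measurable_fst).prodMk measurable_snd)
    have h2 : Measurable fun p : (E × ℝ) × E => softKernel ε (p.1.1 - p.2) :=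
      (measurable_softKernel ε).comp ((measurable_fst.comp measurable_fst).sub measurable_snd)
    exact (h1.smul h2).stronglyMeasurable
  exact (this.integral_prod_right').measurable.neg

/-- Used at `y = L n`, where the Gaussian factor is a multiple of `1 / (n + 2)`: it expresses that
`1 / n` beats `exp (2 T L n)` for every `T`. -/
lemma tendsto_exp_mul_pow_mul_exp_neg_sq {A b : ℝ} (hA : 0 < A) :
    Tendsto (fun y : ℝ => Real.exp (b * y) * y ^ 3 * Real.exp (-(y ^ 2 / A))) atTop (𝓝 0) := by
  refine squeeze_zero' ?_ ?_ (Real.tendsto_pow_mul_exp_neg_atTop_nhds_zero 3)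
  · filter_upwards [eventually_ge_atTop 0] with y hy
    positivity
  · filter_upwards [eventually_ge_atTop 0, eventually_ge_atTop (A * (b + 1))] with y hy hy'
    rw [mul_comm (Real.exp (b * y)), mul_assoc, ← Real.exp_add]
    have h1 : (b + 1) * y ≤ y ^ 2 / A := by
      rw [le_div_iff₀ hA]; nlinarith
    gcongr
    linarith

/-- **Liouville's theorem** for the motion in the gravitational field of a time dependent bounded
density with bounded support. -/
theorem measurePreserving_of_boundedDensity {c R T : ℝ} (hT : 0 ≤ T) {ρ : ℝ → E → ℝ}
    (hρm : Measurable (Function.uncurry ρ)) (hρ : ∀ t, IsBoundedDensity c R (ρ t))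
    {x v : E × E → ℝ → E}
    (hxv : ∀ z, IsTrajectory (fun y t => softField 0 (ρ t) y) T (x z) (v z))
    (h0 : ∀ z, (x z 0, v z 0) = z) :
    MeasurePreserving (fun z => (x z T, v z T)) volume volume := by
  have hc : 0 ≤ c := ((hρ 0).nonneg 0).trans ((hρ 0).le 0)
  -- Up to the logarithm, the first summand is the Lipschitz constant of the softened field; the `+
  -- 1` ensures `1 ≤ L n`.
  set A := 8 * c * (6 * unitVol + volume.real (Metric.closedBall (0 : E) R)) + 1 with hA
  have hA1 : 1 ≤ A := by
    have := unitVol_nonneg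
    have : 0 ≤ volume.real (Metric.closedBall (0 : E) R) := measureReal_nonneg
    rw [hA]; linarith [(by positivity :
      0 ≤ 8 * c * (6 * unitVol + volume.real (Metric.closedBall (0 : E) R)))]
  have hA0 : 0 < A := by linarith
  set ε : ℕ → ℝ := fun n => 1 / (n + 1) with hε
  have hε0 : ∀ n, 0 < ε n := fun n => by simp only [hε]; positivity
  have hεinv : ∀ n, 1 + (ε n)⁻¹ = n + 2 := fun n => by simp only [hε]; field_simp; ring
  set ℓ : ℕ → ℝ := fun n => 1 + Real.log (n + 2) with hℓ
  have hℓ1 : ∀ n, 1 ≤ ℓ n := fun n => by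
    have : 0 ≤ Real.log ((n : ℝ) + 2) :=
      Real.log_nonneg (by linarith [(Nat.cast_nonneg n : (0 : ℝ) ≤ n)])
    simp only [hℓ]; linarith
  set L : ℕ → ℝ := fun n => √(A * ℓ n) with hL
  have hLsq : ∀ n, L n ^ 2 = A * ℓ n := fun n =>
    Real.sq_sqrt (mul_nonneg hA0.le (by linarith [hℓ1 n]))
  have hL1 : ∀ n, 1 ≤ L n := fun n =>
    Real.one_le_sqrt.2 (one_le_mul_of_one_le_of_one_le hA1 (hℓ1 n))
  have hconv : ∀ n, 8 * (c * convBound R (6 * unitVol * Real.log (1 + (ε n)⁻¹))) ≤ L n ^ 2 := by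
    intro n
    rw [hεinv, hLsq, hA, convBound]
    have h1 := hℓ1 n
    have h2 : Real.log ((n : ℝ) + 2) ≤ ℓ n := by simp only [hℓ]; linarith
    have h3 := unitVol_nonneg
    have h4 : 0 ≤ volume.real (Metric.closedBall (0 : E) R) := measureReal_nonneg
    have h5 : 6 * unitVol * Real.log (n + 2) + volume.real (Metric.closedBall (0 : E) R) ≤
        (6 * unitVol + volume.real (Metric.closedBall (0 : E) R)) * ℓ n := by
      have := mul_le_mul_of_nonneg_left h2 (by positivity : 0 ≤ 6 * unitVol)
      have := le_mul_of_one_le_right h4 h1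
      linarith
    have := mul_le_mul_of_nonneg_left h5 (by positivity : 0 ≤ 8 * c)
    linarith
  have hLtop : Tendsto L atTop atTop := by
    refine Real.tendsto_sqrt_atTop.comp (Tendsto.const_mul_atTop hA0 ?_)
    refine tendsto_atTop_add_const_left _ _ (Real.tendsto_log_atTop.comp ?_)
    exact tendsto_atTop_add_const_right _ _ tendsto_natCast_atTop_atTop
  refine measurePreserving_flow (G := fun y t => softField 0 (ρ t) y)
    (F := fun n y t => softField (ε n) (ρ t) y) (L := L) (δ := fun n => L n ^ 2 * ε n)
    (measurable_softField hρm 0) (fun y s => (hρ s).norm_softField_le 0 y) hT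
    (fun n => measurable_softField hρm (ε n)) (fun n y s => (hρ s).norm_softField_le (ε n) y) hL1
    (fun n y s => ?_) (fun n y y' s => ?_) ?_ hxv h0
  · refine ((hρ s).norm_softField_zero_sub_le (hε0 n) y).trans ?_
    have := mul_le_mul_of_nonneg_right (hconv n) (hε0 n).le
    have h6 : 0 ≤ c * convBound R (6 * unitVol * Real.log (1 + (ε n)⁻¹)) := by
      rw [hεinv, convBound]
      have := unitVol_nonneg
      have : 0 ≤ Real.log ((n : ℝ) + 2) :=
        Real.log_nonneg (by linarith [(Nat.cast_nonneg n : (0 : ℝ) ≤ n)])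
      positivity
    nlinarith [hε0 n, mul_nonneg h6 (hε0 n).le]
  · exact ((hρ s).norm_softField_sub_le (hε0 n) y y').trans
      (mul_le_mul_of_nonneg_right (hconv n) (norm_nonneg _))
  · have key := ((tendsto_exp_mul_pow_mul_exp_neg_sq (b := 2 * T) hA0).comp hLtop).const_mul
      (4 * Real.exp 1)
    rw [mul_zero] at key
    refine squeeze_zero (fun n => ?_) (fun n => ?_) key
    · have := hL1 n
      have := hε0 n
      positivity
    · have hLn := hL1 n
      -- Since `L n ^ 2 = A * (1 + log (n + 2))`, the rate `1 / (n + 2)` is exactly a Gaussian in `L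
      -- n`.
      have h7 : Real.exp (-(L n ^ 2 / A)) = Real.exp (-1) * ((n : ℝ) + 2)⁻¹ := by
        rw [hLsq, mul_div_cancel_left₀ _ hA0.ne', hℓ, neg_add, Real.exp_add, Real.exp_neg
          (Real.log _), Real.exp_log (by positivity)]
      have h8 : Real.exp 1 * Real.exp (-(L n ^ 2 / A)) = ((n : ℝ) + 2)⁻¹ := by
        rw [h7, ← mul_assoc, ← Real.exp_add]; simp
      have h9 : L n ^ 3 / (n + 1) + L n * (L n ^ 2 * ε n) = 2 * L n ^ 3 * ((n : ℝ) + 1)⁻¹ := by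
        simp only [hε]; ring
      have h10 : ((n : ℝ) + 1)⁻¹ ≤ 2 * ((n : ℝ) + 2)⁻¹ := by
        rw [← div_eq_mul_inv, inv_eq_one_div, div_le_div_iff₀ (by positivity) (by positivity)]
        linarith [(Nat.cast_nonneg n : (0 : ℝ) ≤ n)]
      simp only [Function.comp]
      rw [h9]
      calc Real.exp (2 * T * L n) * (2 * L n ^ 3 * ((n : ℝ) + 1)⁻¹)
          ≤ Real.exp (2 * T * L n) * (2 * L n ^ 3 * (2 * ((n : ℝ) + 2)⁻¹)) := by gcongr
        _ = _ := by rw [← h8]; ring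

/-! ### Transport of a bounded datum and change of variables -/

/-- A measurable phase space density with values in `[0, C]` that vanishes off the ball of
radius `r`. -/
structure IsBoundedDatum (C r : ℝ) (g : E × E → ℝ) : Prop where
  measurable : Measurable g
  nonneg : ∀ z, 0 ≤ g z
  le : ∀ z, g z ≤ C
  eq_zero : ∀ z, r < ‖z‖ → g z = 0

lemma IsBoundedDatum.nonneg_bound {C r : ℝ} {g : E × E → ℝ} (hg : IsBoundedDatum C r g) : 0 ≤ C :=
  (hg.nonneg 0).trans (hg.le 0)

lemma IsBoundedDatum.integrable_mul {C r : ℝ} {g : E × E → ℝ} (hg : IsBoundedDatum C r g)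
    {φ : E × E → ℝ} (hφ : Measurable φ) {b : ℝ} (hb : ∀ z, ‖z‖ ≤ r → ‖φ z‖ ≤ b) :
    Integrable fun z => φ z * g z := by
  have h1 : Integrable ((Metric.closedBall (0 : E × E) r).indicator fun _ => |b| * C) :=
    (integrable_indicator_iff Metric.isClosed_closedBall.measurableSet).2
      (integrableOn_const measure_closedBall_lt_top.ne)
  refine h1.mono' (hφ.mul hg.measurable).aestronglyMeasurable (Eventually.of_forall fun z => ?_)
  by_cases hz : r < ‖z‖
  · rw [hg.eq_zero z hz, mul_zero, norm_zero]
    exact indicator_nonneg (fun _ _ => mul_nonneg (abs_nonneg _) hg.nonneg_bound) _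
  · rw [indicator_of_mem (by simpa using hz), norm_mul, Real.norm_of_nonneg (hg.nonneg z)]
    exact mul_le_mul ((hb z (not_lt.1 hz)).trans (le_abs_self b)) (hg.le z) (hg.nonneg z)
      (abs_nonneg _)

lemma IsBoundedDatum.integrable {C r : ℝ} {g : E × E → ℝ} (hg : IsBoundedDatum C r g) :
    Integrable g := by
  simpa using hg.integrable_mul (φ := fun _ => 1) measurable_const (b := 1) (by simp)

lemma IsBoundedDatum.integrable_section {C r : ℝ} {g : E × E → ℝ} (hg : IsBoundedDatum C r g)
    (x : E) : Integrable (fun v => g (x, v)) ∧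
      ∫ v, g (x, v) ≤ C * volume.real (Metric.closedBall (0 : E) r) := by
  have h1 : Integrable ((Metric.closedBall (0 : E) r).indicator fun _ => C) :=
    (integrable_indicator_iff Metric.isClosed_closedBall.measurableSet).2
      (integrableOn_const measure_closedBall_lt_top.ne)
  have hle : ∀ v, g (x, v) ≤ (Metric.closedBall (0 : E) r).indicator (fun _ => C) v := by
    intro v
    by_cases hv : r < ‖v‖
    · rw [hg.eq_zero (x, v) (hv.trans_le (norm_snd_le (x, v)))]
      exact indicator_nonneg (fun _ _ => hg.nonneg_bound) _
    · rw [indicator_of_mem (by simpa using hv)]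
      exact hg.le _
  have hi : Integrable fun v => g (x, v) := by
    refine h1.mono' (hg.measurable.comp measurable_prodMk_left).aestronglyMeasurable
      (Eventually.of_forall fun v => ?_)
    rw [Real.norm_of_nonneg (hg.nonneg _)]
    exact hle v
  refine ⟨hi, (integral_mono hi h1 hle).trans (le_of_eq ?_)⟩
  rw [integral_indicator_const _ Metric.isClosed_closedBall.measurableSet, smul_eq_mul, mul_comm]

lemma IsBoundedDatum.isBoundedDensity {C r : ℝ} {g : E × E → ℝ} (hg : IsBoundedDatum C r g) :
    IsBoundedDensity (C * volume.real (Metric.closedBall (0 : E) r)) r fun x => ∫ v, g (x, v) where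
  measurable := (hg.measurable.stronglyMeasurable.integral_prod_right').measurable
  nonneg x := integral_nonneg fun v => hg.nonneg _
  le x := (hg.integrable_section x).2
  eq_zero x hx := by
    have : ∀ v, g (x, v) = 0 := fun v => hg.eq_zero _ (hx.trans_le (norm_fst_le (x, v)))
    simp [this]

/-- The field of the spatial density is the phase space integral of the kernel. -/
lemma IsBoundedDatum.softField_eq {C r : ℝ} {g : E × E → ℝ} (hg : IsBoundedDatum C r g)
    (ε : ℝ) (x : E) : Integrable (fun z : E × E => g z • softKernel ε (x - z.1)) ∧
      softField ε (fun y => ∫ v, g (y, v)) x = -∫ z : E × E, g z • softKernel ε (x - z.1) := by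
  have hk : Measurable fun z : E × E => softKernel ε (x - z.1) :=
    (measurable_softKernel ε).comp (measurable_const.sub measurable_fst)
  have hi : Integrable (fun z : E × E => g z • softKernel ε (x - z.1)) := by
    have hm : Measurable fun z : E × E => g z • softKernel ε (x - z.1) := hg.measurable.smul hk
    refine (integrable_prod_iff hm.aestronglyMeasurable).2 ⟨?_, ?_⟩
    · exact Eventually.of_forall fun y => (hg.integrable_section y).1.smul_const (softKernel ε (x - y))
    · refine (hg.isBoundedDensity.integrable_softKernel ε x).norm.congr
        (Eventually.of_forall fun y => ?_)
      simp only [norm_smul]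
      rw [integral_mul_const, Real.norm_of_nonneg (integral_nonneg fun v => hg.nonneg _)]
      simp only [Real.norm_of_nonneg (hg.nonneg _)]
  refine ⟨hi, ?_⟩
  rw [softField, Measure.volume_eq_prod, integral_prod _ hi]
  simp only [integral_smul_const]

lemma measurable_indicator_of_inter {α : Type*} [MeasurableSpace α] {D : Set α} {φ : α → ℝ}
    (hD : MeasurableSet D) (h : ∀ s, MeasurableSet s → MeasurableSet (D ∩ φ ⁻¹' s)) :
    Measurable (D.indicator φ) := by
  intro s hs
  rw [indicator_preimage, Set.ite, inter_comm]
  exact (h s hs).union (((measurable_const (a := (0 : ℝ))) hs).diff hD)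

namespace IsSolution

variable {g : E → E → ℝ} {T C r : ℝ} {X V : ℝ → E → E → E} {f : E → E → ℝ → ℝ}

lemma continuous_flow_apply (h : IsSolution g T X V f) {t : ℝ} (ht : t ∈ Icc 0 T) :
    Continuous fun z : E × E => (X t z.1 z.2, V t z.1 z.2) := by
  refine continuousOn_univ.1 (h.continuous_flow.comp (f := fun z : E × E => (t, z))
    (by fun_prop) fun z _ => ⟨ht, mem_univ _⟩)

lemma measurableEmbedding_flow (h : IsSolution g T X V f) {t : ℝ} (ht : t ∈ Icc 0 T) :
    MeasurableEmbedding fun z : E × E => (X t z.1 z.2, V t z.1 z.2) :=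
  (h.continuous_flow_apply ht).measurableEmbedding (h.bijective_flow t ht).1

lemma exists_flow_bound (h : IsSolution g T X V f) (r : ℝ) :
    ∃ R, ∀ t ∈ Icc 0 T, ∀ z : E × E, ‖z‖ ≤ r → ‖(X t z.1 z.2, V t z.1 z.2)‖ ≤ R := by
  have hK : IsCompact (Icc 0 T ×ˢ Metric.closedBall (0 : E × E) r) :=
    isCompact_Icc.prod (isCompact_closedBall _ _)
  obtain ⟨R, hR⟩ := (hK.image_of_continuousOn
    (h.continuous_flow.mono (prod_mono_right (subset_univ _)))).isBounded.exists_norm_le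
  exact ⟨R, fun t ht z hz => hR _ ⟨(t, z), ⟨ht, by simpa using hz⟩, rfl⟩⟩

lemma exists_preimage (h : IsSolution g T X V f) {t : ℝ} (ht : t ∈ Icc 0 T) (y : E × E) :
    ∃ z : E × E, (X t z.1 z.2, V t z.1 z.2) = y ∧ f y.1 y.2 t = g z.1 z.2 := by
  obtain ⟨z, hz⟩ := (h.bijective_flow t ht).2 y
  exact ⟨z, hz, by rw [← hz]; exact h.transport _ _ t ht⟩

/-- The solution is jointly measurable in time and phase space. -/
lemma measurable_indicator (h : IsSolution g T X V f) (hg : Measurable fun z : E × E => g z.1 z.2) :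
    Measurable fun p : ℝ × E × E =>
      (Icc 0 T ×ˢ (univ : Set (E × E))).indicator (fun p => f p.2.1 p.2.2 p.1) p := by
  set D : Set (ℝ × E × E) := Icc 0 T ×ˢ univ with hD
  have hDm : MeasurableSet D := measurableSet_Icc.prod MeasurableSet.univ
  let Θ : ℝ × E × E → ℝ × E × E := fun p => (p.1, X p.1 p.2.1 p.2.2, V p.1 p.2.1 p.2.2)
  have hΘc : ContinuousOn Θ D := continuousOn_fst.prodMk h.continuous_flow
  have hΘi : InjOn Θ D := by
    rintro ⟨t, z⟩ ht ⟨t', z'⟩ _ heq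
    have h1 : t = t' := congrArg Prod.fst heq
    subst h1
    exact Prod.ext rfl ((h.bijective_flow t ht.1).1 (congrArg Prod.snd heq))
  have hΘs : Θ '' D = D := by
    ext ⟨t, y⟩
    constructor
    · rintro ⟨⟨t', z⟩, hz, heq⟩
      have : t' = t := congrArg Prod.fst heq
      subst this
      exact hz
    · rintro ⟨ht, -⟩
      obtain ⟨z, hz⟩ := (h.bijective_flow t ht).2 y
      exact ⟨(t, z), ⟨ht, mem_univ _⟩, Prod.ext rfl hz⟩
  refine measurable_indicator_of_inter hDm fun s hs => ?_
  -- Superlevel information on `f` is the image under `Θ` of that on the datum, and injective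
  -- continuous images of Borel sets are Borel (Lusin–Souslin).
  have hpre : D ∩ (fun p : ℝ × E × E => f p.2.1 p.2.2 p.1) ⁻¹' s =
      Θ '' (D ∩ (fun p : ℝ × E × E => g p.2.1 p.2.2) ⁻¹' s) := by
    ext ⟨t, y⟩
    constructor
    · rintro ⟨hp, hs'⟩
      rw [← hΘs] at hp
      obtain ⟨⟨t', z⟩, hz, heq⟩ := hp
      refine ⟨(t', z), ⟨hz, ?_⟩, heq⟩
      rw [← heq] at hs'
      change f (X t' z.1 z.2) (V t' z.1 z.2) t' ∈ s at hs'
      rwa [h.transport _ _ t' hz.1] at hs'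
    · rintro ⟨⟨t', z⟩, ⟨hz, hs'⟩, heq⟩
      rw [← heq]
      refine ⟨hΘs ▸ mem_image_of_mem Θ hz, ?_⟩
      change f (X t' z.1 z.2) (V t' z.1 z.2) t' ∈ s
      rwa [h.transport _ _ t' hz.1]
  rw [hpre]
  exact (hDm.inter ((hg.comp measurable_snd) hs)).image_of_continuousOn_injOn
    (hΘc.mono inter_subset_left) (hΘi.mono inter_subset_left)

end IsSolution

/-- The spatial density of `f`, set to zero off the time interval `[0, T]`. -/
noncomputable def cutDensity (f : E → E → ℝ → ℝ) (T t : ℝ) (y : E) : ℝ :=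
  (Icc 0 T).indicator (fun s => density f y s) t

lemma cutDensity_of_mem {f : E → E → ℝ → ℝ} {T t : ℝ} (ht : t ∈ Icc 0 T) :
    cutDensity f T t = fun y => ∫ v, f y v t := by
  ext y; rw [cutDensity, indicator_of_mem ht]; rfl

lemma field_eq_softField {f : E → E → ℝ → ℝ} {T t : ℝ} (ht : t ∈ Icc 0 T) (x : E) :
    field f x t = softField 0 (cutDensity f T t) x := by
  rw [cutDensity_of_mem ht, field, softField]
  congr 2
  ext1 y
  rw [softKernel, soft_zero_left, smul_smul, div_eq_mul_inv]
  rfl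

namespace IsSolution

variable {g : E → E → ℝ} {T C r : ℝ} {X V : ℝ → E → E → E} {f : E → E → ℝ → ℝ}

lemma isBoundedDatum (h : IsSolution g T X V f) (hg : IsBoundedDatum C r fun z => g z.1 z.2)
    {R t : ℝ} (ht : t ∈ Icc 0 T)
    (hR : ∀ z : E × E, ‖z‖ ≤ r → ‖(X t z.1 z.2, V t z.1 z.2)‖ ≤ R) :
    IsBoundedDatum C R fun z => f z.1 z.2 t where
  measurable := by
    have := (h.measurable_indicator hg.measurable).comp (measurable_prodMk_left (x := t))
    convert this using 1
    ext z
    simp [Function.comp, indicator, ht]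
  nonneg y := by
    obtain ⟨z, -, hz⟩ := h.exists_preimage ht y
    rw [hz]; exact hg.nonneg z
  le y := by
    obtain ⟨z, -, hz⟩ := h.exists_preimage ht y
    rw [hz]; exact hg.le z
  eq_zero y hy := by
    obtain ⟨z, hzy, hz⟩ := h.exists_preimage ht y
    rw [hz]
    refine hg.eq_zero z (not_le.1 fun hzr => ?_)
    have := hR z hzr
    rw [hzy] at this
    linarith

lemma measurable_cutDensity (h : IsSolution g T X V f)
    (hg : Measurable fun z : E × E => g z.1 z.2) :
    Measurable (Function.uncurry (cutDensity f T)) := by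
  have h1 := (h.measurable_indicator hg).comp
    (MeasurableEquiv.prodAssoc (α := ℝ) (β := E) (γ := E)).measurable
  convert (h1.stronglyMeasurable.integral_prod_right' (ν := volume)).measurable using 1
  ext ⟨t, y⟩
  by_cases ht : t ∈ Icc 0 T
  · simp [Function.uncurry, cutDensity, density, indicator, ht.1, ht.2, MeasurableEquiv.prodAssoc]
  · have : ¬(0 ≤ t ∧ t ≤ T) := ht
    simp [Function.uncurry, cutDensity, indicator, this, MeasurableEquiv.prodAssoc]

lemma isBoundedDensity_cutDensity (h : IsSolution g T X V f)
    (hg : IsBoundedDatum C r fun z => g z.1 z.2) {R : ℝ}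
    (hR : ∀ t ∈ Icc 0 T, ∀ z : E × E, ‖z‖ ≤ r → ‖(X t z.1 z.2, V t z.1 z.2)‖ ≤ R) (t : ℝ) :
    IsBoundedDensity (C * volume.real (Metric.closedBall (0 : E) R)) R (cutDensity f T t) := by
  by_cases ht : t ∈ Icc 0 T
  · rw [cutDensity_of_mem ht]
    exact (h.isBoundedDatum hg ht (hR t ht)).isBoundedDensity
  · have : cutDensity f T t = fun _ => 0 := by
      ext y; rw [cutDensity, indicator_of_notMem ht]
    rw [this]
    exact ⟨measurable_const, fun _ => le_rfl,
      fun _ => mul_nonneg hg.nonneg_bound measureReal_nonneg, fun _ _ => rfl⟩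

lemma isTrajectory (h : IsSolution g T X V f) (z : E × E) :
    IsTrajectory (fun y s => softField 0 (cutDensity f T s) y) T
      (fun s => X s z.1 z.2) (fun s => V s z.1 z.2) where
  deriv_fst := h.deriv_X z.1 z.2
  deriv_snd t ht := by
    rw [← field_eq_softField ht]
    exact h.deriv_V z.1 z.2 t ht

/-- The characteristic flow preserves the Lebesgue measure of the phase space. -/
theorem measurePreserving_flow (h : IsSolution g T X V f)
    (hg : IsBoundedDatum C r fun z => g z.1 z.2) {t : ℝ} (ht : t ∈ Icc 0 T) :
    MeasurePreserving (fun z : E × E => (X t z.1 z.2, V t z.1 z.2)) volume volume := by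
  obtain ⟨R, hR⟩ := h.exists_flow_bound r
  have hsub : Icc 0 t ⊆ Icc 0 T := Icc_subset_Icc_right ht.2
  refine measurePreserving_of_boundedDensity (ρ := cutDensity f T) ht.1
    (h.measurable_cutDensity hg.measurable)
    (h.isBoundedDensity_cutDensity hg hR) (x := fun z s => X s z.1 z.2)
    (v := fun z s => V s z.1 z.2) (fun z => ?_) (fun z => ?_)
  · exact ⟨fun s hs => ((h.isTrajectory z).deriv_fst s (hsub hs)).mono hsub,
      fun s hs => ((h.isTrajectory z).deriv_snd s (hsub hs)).mono hsub⟩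
  · simp [h.init_X, h.init_V]

/-- Change of variables along the flow. -/
lemma integral_smul_eq {F : Type*} [NormedAddCommGroup F] [NormedSpace ℝ F]
    (h : IsSolution g T X V f)
    (hg : IsBoundedDatum C r fun z => g z.1 z.2) {t : ℝ} (ht : t ∈ Icc 0 T) (ψ : E × E → F) :
    ∫ z : E × E, f z.1 z.2 t • ψ z =
      ∫ z : E × E, g z.1 z.2 • ψ (X t z.1 z.2, V t z.1 z.2) := by
  rw [← (h.measurePreserving_flow hg ht).integral_comp (h.measurableEmbedding_flow ht)]
  simp only [h.transport _ _ t ht]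

end IsSolution

/-! ### Energy balance in particle labels, with softened interaction -/

lemma norm_softKernel_le_inv_sq {ε : ℝ} (hε : 0 < ε) (a : E) : ‖softKernel ε a‖ ≤ (ε ^ 2)⁻¹ := by
  have hs := soft_pos hε a
  rw [softKernel, norm_smul, norm_inv, norm_pow, Real.norm_of_nonneg hs.le]
  calc (soft ε a ^ 3)⁻¹ * ‖a‖ ≤ (soft ε a ^ 3)⁻¹ * soft ε a := by
        gcongr; exact norm_le_soft ε a
    _ = (soft ε a ^ 2)⁻¹ := by field_simp
    _ ≤ (ε ^ 2)⁻¹ := by gcongr; exact le_soft a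

lemma hasDerivAt_inv_soft {ε : ℝ} (hε : 0 < ε) {x : ℝ → E} {x' : E} {t : ℝ}
    (hx : HasDerivAt x x' t) :
    HasDerivAt (fun s => (soft ε (x s))⁻¹) (-inner ℝ (softKernel ε (x t)) x') t := by
  have hs := soft_pos hε (x t)
  have h1 := ((hx.norm_sq.add_const (ε ^ 2)).sqrt
    (by positivity : ‖x t‖ ^ 2 + ε ^ 2 ≠ 0)).inv hs.ne'
  refine h1.congr_deriv ?_
  change -(2 * inner ℝ (x t) x' / (2 * soft ε (x t))) / soft ε (x t) ^ 2 = _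
  rw [softKernel, real_inner_smul_left]
  field_simp

section energy

variable {Ω : Type*} [MeasurableSpace Ω] (μ : Measure Ω)

/-- The kinetic energy of the particles with velocities `v t ω`. -/
noncomputable def kinetic (v : Ω → ℝ → E) (t : ℝ) : ℝ := ∫ ω, 1 / 2 * ‖v ω t‖ ^ 2 ∂μ

/-- The softened interaction energy of the particles with positions `x t ω`. -/
noncomputable def softPotential (ε : ℝ) (x : Ω → ℝ → E) (t : ℝ) : ℝ :=
  ∫ p : Ω × Ω, 1 / 2 * (soft ε (x p.1 t - x p.2 t))⁻¹ ∂(μ.prod μ)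

variable {μ} [IsFiniteMeasure μ] {x v : Ω → ℝ → E} {G : E → ℝ → E} {T B W : ℝ}

lemma hasDerivAt_kinetic (hxv : ∀ ω, IsTrajectory G T (x ω) (v ω))
    (hvm : ∀ t ∈ Icc 0 T, Measurable fun ω => v ω t)
    (hGm : ∀ t ∈ Icc 0 T, Measurable fun ω => G (x ω t) t)
    (hB : ∀ y s, ‖G y s‖ ≤ B) (hW : ∀ᵐ ω ∂μ, ∀ t ∈ Icc 0 T, ‖v ω t‖ ≤ W)
    {t : ℝ} (ht : t ∈ Ioo 0 T) :
    HasDerivAt (kinetic μ v) (∫ ω, inner ℝ (v ω t) (G (x ω t) t) ∂μ) t := by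
  have hnhds : Ioo 0 T ∈ 𝓝 t := Ioo_mem_nhds ht.1 ht.2
  have hsub : Ioo 0 T ⊆ Icc 0 T := Ioo_subset_Icc_self
  refine (hasDerivAt_integral_of_dominated_loc_of_deriv_le (𝕜 := ℝ) (s := Ioo 0 T)
    (F := fun t ω => 1 / 2 * ‖v ω t‖ ^ 2) (F' := fun t ω => inner ℝ (v ω t) (G (x ω t) t))
    (bound := fun _ => W * B) hnhds ?_ ?_ ?_ ?_ (integrable_const _) ?_).2
  · filter_upwards [hnhds] with s hs
    exact (((hvm s (hsub hs)).norm.pow_const 2).const_mul _).aestronglyMeasurable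
  · refine Integrable.of_bound
      (((hvm t (hsub ht)).norm.pow_const 2).const_mul _).aestronglyMeasurable (1 / 2 * W ^ 2) ?_
    filter_upwards [hW] with ω hω
    rw [Real.norm_of_nonneg (by positivity)]
    gcongr
    exact hω t (hsub ht)
  · exact ((hvm t (hsub ht)).inner (hGm t (hsub ht))).aestronglyMeasurable
  · filter_upwards [hW] with ω hω s hs
    refine (norm_inner_le_norm _ _).trans ?_
    have := hω s (hsub hs)
    exact mul_le_mul this (hB _ _) (norm_nonneg _) ((norm_nonneg _).trans this)
  · refine Eventually.of_forall fun ω s hs => ?_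
    have h1 := ((hxv ω).deriv_snd s (hsub hs)).hasDerivAt (Icc_mem_nhds hs.1 hs.2)
    exact (h1.norm_sq.const_mul (1 / 2)).congr_deriv (by ring)

lemma continuousOn_kinetic (hxv : ∀ ω, IsTrajectory G T (x ω) (v ω))
    (hvm : ∀ t ∈ Icc 0 T, Measurable fun ω => v ω t)
    (hW : ∀ᵐ ω ∂μ, ∀ t ∈ Icc 0 T, ‖v ω t‖ ≤ W) : ContinuousOn (kinetic μ v) (Icc 0 T) := by
  refine continuousOn_of_dominated (bound := fun _ => 1 / 2 * W ^ 2) (fun s hs => ?_)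
    (fun s hs => ?_) (integrable_const _) (Eventually.of_forall fun ω => ?_)
  · exact (((hvm s hs).norm.pow_const 2).const_mul _).aestronglyMeasurable
  · filter_upwards [hW] with ω hω
    rw [Real.norm_of_nonneg (by positivity)]
    gcongr
    exact hω s hs
  · have : ContinuousOn (v ω) (Icc 0 T) := fun s hs => ((hxv ω).deriv_snd s hs).continuousWithinAt
    fun_prop

/-- Exchanging the two particles and using that the kernel is odd, the terms with `v p.1` and `v
p.2` contribute equally, which cancels the factor `1 / 2`. -/
lemma hasDerivAt_softPotential {ε : ℝ} (hε : 0 < ε) (hxv : ∀ ω, IsTrajectory G T (x ω) (v ω))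
    (hxm : ∀ t ∈ Icc 0 T, Measurable fun ω => x ω t)
    (hvm : ∀ t ∈ Icc 0 T, Measurable fun ω => v ω t)
    (hW : ∀ᵐ ω ∂μ, ∀ t ∈ Icc 0 T, ‖v ω t‖ ≤ W) {t : ℝ} (ht : t ∈ Ioo 0 T) :
    HasDerivAt (softPotential μ ε x)
      (-∫ ω, inner ℝ (v ω t) (∫ ω', softKernel ε (x ω t - x ω' t) ∂μ) ∂μ) t := by
  have hnhds : Ioo 0 T ∈ 𝓝 t := Ioo_mem_nhds ht.1 ht.2
  have hsub : Ioo 0 T ⊆ Icc 0 T := Ioo_subset_Icc_self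
  have hW1 : ∀ᵐ p : Ω × Ω ∂(μ.prod μ), ∀ t ∈ Icc 0 T, ‖v p.1 t‖ ≤ W :=
    Measure.quasiMeasurePreserving_fst.ae hW
  have hW2 : ∀ᵐ p : Ω × Ω ∂(μ.prod μ), ∀ t ∈ Icc 0 T, ‖v p.2 t‖ ≤ W :=
    Measure.quasiMeasurePreserving_snd.ae hW
  have hxm1 : ∀ t ∈ Icc 0 T, Measurable fun p : Ω × Ω => x p.1 t - x p.2 t := fun t ht =>
    ((hxm t ht).comp measurable_fst).sub ((hxm t ht).comp measurable_snd)
  have hKm : Measurable fun p : Ω × Ω => softKernel ε (x p.1 t - x p.2 t) :=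
    (measurable_softKernel ε).comp (hxm1 t (hsub ht))
  have hv1 : Measurable fun p : Ω × Ω => v p.1 t := (hvm t (hsub ht)).comp measurable_fst
  have hv2 : Measurable fun p : Ω × Ω => v p.2 t := (hvm t (hsub ht)).comp measurable_snd
  have hb : ∀ (a b : E), ‖b‖ ≤ W → ‖inner ℝ (softKernel ε a) b‖ ≤ (ε ^ 2)⁻¹ * W := fun a b hbW =>
    (norm_inner_le_norm _ _).trans (mul_le_mul (norm_softKernel_le_inv_sq hε a) hbW
      (norm_nonneg _) (by positivity))
  have hi1 : Integrable (fun p : Ω × Ω => inner ℝ (softKernel ε (x p.1 t - x p.2 t)) (v p.1 t))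
      (μ.prod μ) := by
    refine Integrable.of_bound (hKm.inner hv1).aestronglyMeasurable ((ε ^ 2)⁻¹ * W) ?_
    filter_upwards [hW1] with p hp using hb _ _ (hp t (hsub ht))
  have hi2 : Integrable (fun p : Ω × Ω => inner ℝ (softKernel ε (x p.1 t - x p.2 t)) (v p.2 t))
      (μ.prod μ) := by
    refine Integrable.of_bound (hKm.inner hv2).aestronglyMeasurable ((ε ^ 2)⁻¹ * W) ?_
    filter_upwards [hW2] with p hp using hb _ _ (hp t (hsub ht))
  have key := (hasDerivAt_integral_of_dominated_loc_of_deriv_le (𝕜 := ℝ) (s := Ioo 0 T)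
    (μ := μ.prod μ) (F := fun t (p : Ω × Ω) => 1 / 2 * (soft ε (x p.1 t - x p.2 t))⁻¹)
    (F' := fun t (p : Ω × Ω) => 1 / 2 * -inner ℝ (softKernel ε (x p.1 t - x p.2 t))
      (v p.1 t - v p.2 t))
    (bound := fun _ => (ε ^ 2)⁻¹ * W) hnhds ?_ ?_ ?_ ?_ (integrable_const _) ?_).2
  · refine key.congr_deriv ?_
    have hswap : ∫ p : Ω × Ω, inner ℝ (softKernel ε (x p.1 t - x p.2 t)) (v p.2 t) ∂(μ.prod μ) =
        -∫ p : Ω × Ω, inner ℝ (softKernel ε (x p.1 t - x p.2 t)) (v p.1 t) ∂(μ.prod μ) := by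
      rw [← integral_prod_swap, ← integral_neg]
      refine integral_congr_ae (Eventually.of_forall fun p => ?_)
      simp only [Prod.fst_swap, Prod.snd_swap]
      rw [← neg_sub (x p.1 t), softKernel_neg, inner_neg_left]
    have hfub : ∫ p : Ω × Ω, inner ℝ (softKernel ε (x p.1 t - x p.2 t)) (v p.1 t) ∂(μ.prod μ) =
        ∫ ω, inner ℝ (v ω t) (∫ ω', softKernel ε (x ω t - x ω' t) ∂μ) ∂μ := by
      rw [integral_prod _ hi1]
      refine integral_congr_ae (Eventually.of_forall fun ω => ?_)
      simp only
      rw [← integral_inner]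
      · simp only [real_inner_comm]
      · refine Integrable.of_bound (hKm.comp measurable_prodMk_left).aestronglyMeasurable
          (ε ^ 2)⁻¹ (Eventually.of_forall fun ω' => norm_softKernel_le_inv_sq hε _)
    rw [← hfub, integral_const_mul, integral_neg]
    simp only [inner_sub_right]
    rw [integral_sub hi1 hi2, hswap]
    ring
  · filter_upwards [hnhds] with s hs
    exact ((((continuous_soft ε).measurable.comp (hxm1 s (hsub hs))).inv).const_mul
      _).aestronglyMeasurable
  · refine Integrable.of_bound ((((continuous_soft ε).measurable.comp
      (hxm1 t (hsub ht))).inv).const_mul _).aestronglyMeasurable (1 / 2 * ε⁻¹)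
      (Eventually.of_forall fun p => ?_)
    have := soft_nonneg ε (x p.1 t - x p.2 t)
    rw [Real.norm_of_nonneg (by positivity)]
    gcongr
    exact le_soft _
  · exact ((hKm.inner (hv1.sub hv2)).neg.const_mul _).aestronglyMeasurable
  · filter_upwards [hW1, hW2] with p h1 h2 s hs
    have e1 := hb (x p.1 s - x p.2 s) _ (h1 s (hsub hs))
    have e2 := hb (x p.1 s - x p.2 s) _ (h2 s (hsub hs))
    rw [norm_mul, norm_neg, inner_sub_right, Real.norm_of_nonneg (by norm_num : (0 : ℝ) ≤ 1 / 2)]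
    have := norm_sub_le (inner ℝ (softKernel ε (x p.1 s - x p.2 s)) (v p.1 s))
      (inner ℝ (softKernel ε (x p.1 s - x p.2 s)) (v p.2 s))
    linarith
  · refine Eventually.of_forall fun p s hs => ?_
    have hn := Icc_mem_nhds hs.1 hs.2
    have h1 := ((hxv p.1).deriv_fst s (hsub hs)).hasDerivAt hn
    have h2 := ((hxv p.2).deriv_fst s (hsub hs)).hasDerivAt hn
    exact (hasDerivAt_inv_soft hε (h1.sub h2)).const_mul _

lemma continuousOn_softPotential {ε : ℝ} (hε : 0 < ε)
    (hxv : ∀ ω, IsTrajectory G T (x ω) (v ω))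
    (hxm : ∀ t ∈ Icc 0 T, Measurable fun ω => x ω t) :
    ContinuousOn (softPotential μ ε x) (Icc 0 T) := by
  refine continuousOn_of_dominated (bound := fun _ => 1 / 2 * ε⁻¹) (fun s hs => ?_)
    (fun s hs => ?_) (integrable_const _) (Eventually.of_forall fun p => ?_)
  · exact ((((continuous_soft ε).measurable.comp (((hxm s hs).comp measurable_fst).sub
      ((hxm s hs).comp measurable_snd))).inv).const_mul _).aestronglyMeasurable
  · refine Eventually.of_forall fun p => ?_
    have := soft_nonneg ε (x p.1 s - x p.2 s)
    rw [Real.norm_of_nonneg (by positivity)]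
    gcongr
    exact le_soft _
  · have h1 : ContinuousOn (x p.1) (Icc 0 T) := fun s hs =>
      ((hxv p.1).deriv_fst s hs).continuousWithinAt
    have h2 : ContinuousOn (x p.2) (Icc 0 T) := fun s hs =>
      ((hxv p.2).deriv_fst s hs).continuousWithinAt
    exact continuousOn_const.mul (((continuous_soft ε).comp_continuousOn (h1.sub h2)).inv₀
      fun s _ => (soft_pos hε _).ne')

/-- **Approximate conservation of energy**: the energy with softened interaction changes at most
at the rate at which the softening perturbs the force. -/
theorem abs_energy_sub_le {ε e : ℝ} (hε : 0 < ε) (hxv : ∀ ω, IsTrajectory G T (x ω) (v ω))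
    (hxm : ∀ t ∈ Icc 0 T, Measurable fun ω => x ω t)
    (hvm : ∀ t ∈ Icc 0 T, Measurable fun ω => v ω t)
    (hGm : ∀ t ∈ Icc 0 T, Measurable fun ω => G (x ω t) t)
    (hB : ∀ y s, ‖G y s‖ ≤ B) (hW : ∀ᵐ ω ∂μ, ∀ t ∈ Icc 0 T, ‖v ω t‖ ≤ W)
    (he : ∀ t ∈ Icc 0 T, ∀ ω, ‖G (x ω t) t + ∫ ω', softKernel ε (x ω t - x ω' t) ∂μ‖ ≤ e)
    {t : ℝ} (ht : t ∈ Icc 0 T) :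
    |(kinetic μ v t - softPotential μ ε x t) - (kinetic μ v 0 - softPotential μ ε x 0)| ≤
      W * e * μ.real univ * t := by
  rcases ht.1.eq_or_lt with rfl | ht0
  · simp
  have hsub : Icc 0 t ⊆ Icc 0 T := Icc_subset_Icc_right ht.2
  -- The mean value theorem is used so that the derivative of the energy need not be integrated in
  -- time.
  obtain ⟨s, hs, hs'⟩ := exists_hasDerivAt_eq_slope
    (fun s => kinetic μ v s - softPotential μ ε x s)
    (fun s => ∫ ω, inner ℝ (v ω s) (G (x ω s) s) ∂μ -
      -∫ ω, inner ℝ (v ω s) (∫ ω', softKernel ε (x ω s - x ω' s) ∂μ) ∂μ) ht0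
    (((continuousOn_kinetic hxv hvm hW).sub (continuousOn_softPotential hε hxv hxm)).mono hsub)
    (fun s hs => (hasDerivAt_kinetic hxv hvm hGm hB hW ⟨hs.1, hs.2.trans_le ht.2⟩).sub
      (hasDerivAt_softPotential hε hxv hxm hvm hW ⟨hs.1, hs.2.trans_le ht.2⟩))
  have hsT : s ∈ Icc 0 T := hsub (Ioo_subset_Icc_self hs)
  have hKi : Measurable fun ω => ∫ ω', softKernel ε (x ω s - x ω' s) ∂μ := by
    have : Measurable fun p : Ω × Ω => softKernel ε (x p.1 s - x p.2 s) :=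
      (measurable_softKernel ε).comp (((hxm s hsT).comp measurable_fst).sub
        ((hxm s hsT).comp measurable_snd))
    exact (this.stronglyMeasurable.integral_prod_right').measurable
  have hi1 : Integrable (fun ω => inner ℝ (v ω s) (G (x ω s) s)) μ := by
    refine Integrable.of_bound ((hvm s hsT).inner (hGm s hsT)).aestronglyMeasurable (W * B) ?_
    filter_upwards [hW] with ω hω
    have := hω s hsT
    exact (norm_inner_le_norm _ _).trans
      (mul_le_mul this (hB _ _) (norm_nonneg _) ((norm_nonneg _).trans this))
  have hi2 : Integrable (fun ω => inner ℝ (v ω s) (∫ ω', softKernel ε (x ω s - x ω' s) ∂μ)) μ := by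
    refine Integrable.of_bound ((hvm s hsT).inner hKi).aestronglyMeasurable
      (W * ((ε ^ 2)⁻¹ * μ.real univ)) ?_
    filter_upwards [hW] with ω hω
    have := hω s hsT
    refine (norm_inner_le_norm _ _).trans
      (mul_le_mul this ?_ (norm_nonneg _) ((norm_nonneg _).trans this))
    exact norm_integral_le_of_norm_le_const (μ := μ) (Eventually.of_forall fun ω' =>
      norm_softKernel_le_inv_sq hε _)
  have hbound : |∫ ω, inner ℝ (v ω s) (G (x ω s) s) ∂μ -
      -∫ ω, inner ℝ (v ω s) (∫ ω', softKernel ε (x ω s - x ω' s) ∂μ) ∂μ| ≤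
      W * e * μ.real univ := by
    rw [sub_neg_eq_add, ← integral_add hi1 hi2]
    rw [← Real.norm_eq_abs]
    refine norm_integral_le_of_norm_le_const (μ := μ) ?_
    filter_upwards [hW] with ω hω
    have := hω s hsT
    rw [← inner_add_right]
    exact (norm_inner_le_norm _ _).trans
      (mul_le_mul this (he s hsT ω) (norm_nonneg _) ((norm_nonneg _).trans this))
  rw [hs', sub_zero, abs_div, abs_of_pos ht0, div_le_iff₀ ht0] at hbound
  exact hbound

end energy

/-! ### Interpolation of the Newton potential -/

/-- The part `|x - y| < s, |w| ≤ a |x - y|^{-1/2}` of phase space, weighted by `1 / |x - y|`. -/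
noncomputable def nearSlow (a s : ℝ) (x : E) : E × E → ℝ :=
  {z : E × E | ‖x - z.1‖ < s ∧ ‖z.2‖ ≤ a / √‖x - z.1‖}.indicator fun z => ‖x - z.1‖⁻¹

lemma measurable_nearSlow (a s : ℝ) (x : E) : Measurable (nearSlow a s x) := by
  refine Measurable.indicator (by fun_prop) ?_
  have h1 : Measurable fun z : E × E => ‖x - z.1‖ := by fun_prop
  have h2 : Measurable fun z : E × E => ‖z.2‖ := by fun_prop
  exact (measurableSet_lt h1 measurable_const).inter
    (measurableSet_le h2 (measurable_const.div h1.sqrt))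

lemma nearSlow_nonneg (a s : ℝ) (x : E) (z : E × E) : 0 ≤ nearSlow a s x z :=
  indicator_nonneg (fun _ _ => by positivity) _

lemma nearSlow_section (a s : ℝ) (x y : E) : (fun w => nearSlow a s x (y, w)) =
    (Metric.closedBall (0 : E) (a / √‖x - y‖)).indicator
      fun _ => (Metric.ball (0 : E) s).indicator (fun u => ‖u‖⁻¹) (x - y) := by
  ext w
  by_cases h1 : ‖x - y‖ < s <;> by_cases h2 : ‖w‖ ≤ a / √‖x - y‖ <;>
    simp [nearSlow, indicator, h1, h2]

lemma integral_nearSlow_section {a : ℝ} (ha : 0 ≤ a) (s : ℝ) (x y : E) :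
    ∫ w, nearSlow a s x (y, w) = (Metric.ball (0 : E) s).indicator
      (fun u => unitVol * ((a / √‖u‖) ^ 3 * ‖u‖⁻¹)) (x - y) := by
  rw [nearSlow_section, integral_indicator_const _ Metric.isClosed_closedBall.measurableSet,
    Measure.addHaar_real_closedBall _ _ (by positivity), finrank_E, smul_eq_mul]
  by_cases h1 : x - y ∈ Metric.ball (0 : E) s
  · rw [indicator_of_mem h1, indicator_of_mem h1, unitVol]; ring
  · rw [indicator_of_notMem h1, indicator_of_notMem h1, mul_zero]

/-- Slow velocities fill a volume of order `r ^ (-3/2)`; with the potential `1 / r` and the Jacobian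
`r ^ 2` this leaves the integrable `r ^ (-1/2)`. -/
lemma integral_nearSlow_radial (a : ℝ) {s : ℝ} (hs : 0 ≤ s) :
    IntegrableOn (fun r : ℝ => r ^ 2 * (unitVol * ((a / √r) ^ 3 * r⁻¹))) (Ioo 0 s) ∧
    ∫ r in Ioo 0 s, r ^ 2 * (unitVol * ((a / √r) ^ 3 * r⁻¹)) = 2 * unitVol * a ^ 3 * √s := by
  have heq : EqOn (fun r : ℝ => r ^ 2 * (unitVol * ((a / √r) ^ 3 * r⁻¹)))
      (fun r => unitVol * a ^ 3 * r ^ (-(1 / 2) : ℝ)) (Ioo 0 s) := by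
    intro r hr
    have hr0 := hr.1
    have h1 : r ^ (-(1 / 2) : ℝ) = (√r)⁻¹ := by
      rw [Real.rpow_neg hr0.le, Real.sqrt_eq_rpow]
    have h2 : 0 < √r := Real.sqrt_pos.2 hr0
    simp only
    rw [h1]
    obtain ⟨q, hq⟩ : ∃ q, q = √r := ⟨_, rfl⟩
    have h3 : r = q ^ 2 := by rw [hq, Real.sq_sqrt hr0.le]
    rw [← hq] at h2 ⊢
    rw [h3]
    field_simp
  have hint : IntegrableOn (fun r : ℝ => unitVol * a ^ 3 * r ^ (-(1 / 2) : ℝ)) (Ioo 0 s) := by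
    have := (intervalIntegral.intervalIntegrable_rpow' (a := 0) (b := s)
      (by norm_num : (-1 : ℝ) < -(1 / 2)))
    rw [intervalIntegrable_iff_integrableOn_Ioc_of_le hs] at this
    exact (this.mono_set Ioo_subset_Ioc_self).const_mul _
  refine ⟨(integrableOn_congr_fun heq measurableSet_Ioo).2 hint, ?_⟩
  rw [setIntegral_congr_fun measurableSet_Ioo heq, integral_const_mul,
    ← integral_Ioc_eq_integral_Ioo, ← intervalIntegral.integral_of_le hs,
    integral_rpow (Or.inl (by norm_num)), Real.sqrt_eq_rpow]
  norm_num
  ring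

lemma integral_nearSlow {a s : ℝ} (ha : 0 ≤ a) (hs : 0 ≤ s) (x : E) :
    Integrable (nearSlow a s x) ∧ ∫ z, nearSlow a s x z = 6 * unitVol ^ 2 * a ^ 3 * √s := by
  obtain ⟨h1, h2⟩ := integral_nearSlow_radial a hs
  have hb := integrableOn_ball_norm (f := fun r => unitVol * ((a / √r) ^ 3 * r⁻¹)) h1
  have hb' := ((integrable_indicator_iff Metric.isOpen_ball.measurableSet).2 hb).comp_sub_left x
  have hint : Integrable (nearSlow a s x) := by
    refine (integrable_prod_iff (measurable_nearSlow a s x).aestronglyMeasurable).2 ⟨?_, ?_⟩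
    · refine Eventually.of_forall fun y => ?_
      rw [nearSlow_section]
      exact (integrable_indicator_iff Metric.isClosed_closedBall.measurableSet).2
        (integrableOn_const measure_closedBall_lt_top.ne)
    · simp only [Real.norm_of_nonneg (nearSlow_nonneg a s x _), integral_nearSlow_section ha]
      exact hb'
  refine ⟨hint, ?_⟩
  rw [Measure.volume_eq_prod, integral_prod _ hint]
  simp only [integral_nearSlow_section ha]
  rw [integral_sub_left_eq_self (fun u => (Metric.ball (0 : E) s).indicator
    (fun u => unitVol * ((a / √‖u‖) ^ 3 * ‖u‖⁻¹)) u) volume x,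
    integral_indicator Metric.isOpen_ball.measurableSet,
    setIntegral_ball_norm (fun r => unitVol * ((a / √r) ^ 3 * r⁻¹)) s, h2, ← unitVol]
  ring

/-- Pointwise interpolation of the Newton potential between mass, kinetic energy and the
sup norm of the phase space density. -/
lemma mul_inv_soft_le {a s ε C q : ℝ} (ha : 0 < a) (hs : 0 < s) (hq : 0 ≤ q)
    (hqC : q ≤ C) (x : E) {z : E × E} (hz : z.1 ≠ x) :
    q * (soft ε (x - z.1))⁻¹ ≤ s⁻¹ * q + (a ^ 2)⁻¹ * (‖z.2‖ ^ 2 * q) + C * nearSlow a s x z := by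
  have hr : 0 < ‖x - z.1‖ := norm_pos_iff.2 (sub_ne_zero.2 hz.symm)
  have hφ : (soft ε (x - z.1))⁻¹ ≤ ‖x - z.1‖⁻¹ := by gcongr; exact norm_le_soft _ _
  have t1 : 0 ≤ s⁻¹ * q := by positivity
  have t2 : 0 ≤ (a ^ 2)⁻¹ * (‖z.2‖ ^ 2 * q) := by positivity
  have t3 : 0 ≤ C * nearSlow a s x z := mul_nonneg (hq.trans hqC) (nearSlow_nonneg _ _ _ _)
  have hle : q * (soft ε (x - z.1))⁻¹ ≤ q * ‖x - z.1‖⁻¹ := by gcongr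
  refine hle.trans ?_
  by_cases h1 : ‖x - z.1‖ < s
  · by_cases h2 : ‖z.2‖ ≤ a / √‖x - z.1‖
    · have : nearSlow a s x z = ‖x - z.1‖⁻¹ := indicator_of_mem (by exact ⟨h1, h2⟩) _
      rw [this] at t3 ⊢
      have := mul_le_mul_of_nonneg_right hqC (inv_nonneg.2 hr.le)
      linarith
    · have h3 : (a / √‖x - z.1‖) ^ 2 ≤ ‖z.2‖ ^ 2 := by
        have := not_le.1 h2
        gcongr
      rw [div_pow, Real.sq_sqrt hr.le] at h3
      have h4 : ‖x - z.1‖⁻¹ ≤ (a ^ 2)⁻¹ * ‖z.2‖ ^ 2 := by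
        calc ‖x - z.1‖⁻¹ = (a ^ 2)⁻¹ * (a ^ 2 / ‖x - z.1‖) := by field_simp
          _ ≤ _ := by gcongr
      have := mul_le_mul_of_nonneg_left h4 hq
      linarith
  · have h3 : ‖x - z.1‖⁻¹ ≤ s⁻¹ := by gcongr; exact not_lt.1 h1
    have := mul_le_mul_of_nonneg_left h3 hq
    linarith

lemma IsBoundedDatum.integrable_norm_sq {C r : ℝ} {g : E × E → ℝ} (hg : IsBoundedDatum C r g) :
    Integrable fun z : E × E => ‖z.2‖ ^ 2 * g z :=
  hg.integrable_mul (φ := fun z => ‖z.2‖ ^ 2) (by fun_prop) (b := r ^ 2) fun z hz => by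
    rw [norm_pow, norm_norm]
    gcongr
    exact (norm_snd_le z).trans hz

/-- The Newton potential of a phase space density is controlled by mass, kinetic energy and the
sup norm. -/
lemma IsBoundedDatum.integral_inv_soft_le {C r : ℝ} {g : E × E → ℝ} (hg : IsBoundedDatum C r g)
    {a s ε : ℝ} (ha : 0 < a) (hs : 0 < s) (hε : 0 < ε) (x : E) :
    ∫ z : E × E, g z * (soft ε (x - z.1))⁻¹ ≤ s⁻¹ * (∫ z, g z) +
      (a ^ 2)⁻¹ * (∫ z : E × E, ‖z.2‖ ^ 2 * g z) + C * (6 * unitVol ^ 2 * a ^ 3 * √s) := by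
  obtain ⟨hn1, hn2⟩ := integral_nearSlow ha.le hs.le x
  have i1 := hg.integrable.const_mul s⁻¹
  have i2 := hg.integrable_norm_sq.const_mul (a ^ 2)⁻¹
  have i3 := hn1.const_mul C
  have i12 : Integrable fun z : E × E => s⁻¹ * g z + (a ^ 2)⁻¹ * (‖z.2‖ ^ 2 * g z) := i1.add i2
  have hl : Integrable fun z : E × E => g z * (soft ε (x - z.1))⁻¹ := by
    simp only [mul_comm (g _)]
    refine hg.integrable_mul (φ := fun z : E × E => (soft ε (x - z.1))⁻¹) ?_ (b := ε⁻¹)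
      fun z _ => ?_
    · exact ((continuous_soft ε).measurable.comp (measurable_const.sub measurable_fst)).inv
    · rw [Real.norm_of_nonneg (inv_nonneg.2 (soft_nonneg _ _))]
      gcongr
      exact le_soft _
  have hae : ∀ᵐ z : E × E, z.1 ≠ x := by
    have : ∀ᵐ y : E, y ≠ x := by simp [ae_iff]
    exact Measure.quasiMeasurePreserving_fst.ae this
  calc ∫ z : E × E, g z * (soft ε (x - z.1))⁻¹
      ≤ ∫ z : E × E, (s⁻¹ * g z + (a ^ 2)⁻¹ * (‖z.2‖ ^ 2 * g z) + C * nearSlow a s x z) := by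
        refine integral_mono_ae hl (i12.add i3) ?_
        filter_upwards [hae] with z hz
        exact mul_inv_soft_le ha hs (hg.nonneg z) (hg.le z) x hz
    _ = _ := by
        rw [integral_add i12 i3, integral_add i1 i2, integral_const_mul,
          integral_const_mul, integral_const_mul, hn2]

/-! ### Energy estimate for solutions -/

/-- The measure on phase space with density `g`. -/
noncomputable def datumMeasure (g : E × E → ℝ) : Measure (E × E) :=
  volume.withDensity fun z => ((g z).toNNReal : ENNReal)

namespace IsBoundedDatum

variable {C r : ℝ} {g : E × E → ℝ}

lemma integral_datumMeasure {F : Type*} [NormedAddCommGroup F] [NormedSpace ℝ F]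
    (hg : IsBoundedDatum C r g) (φ : E × E → F) :
    ∫ z, φ z ∂(datumMeasure g) = ∫ z, g z • φ z := by
  rw [datumMeasure, integral_withDensity_eq_integral_smul hg.measurable.real_toNNReal]
  simp only [NNReal.smul_def, Real.coe_toNNReal _ (hg.nonneg _)]

lemma isFiniteMeasure_datumMeasure (hg : IsBoundedDatum C r g) :
    IsFiniteMeasure (datumMeasure g) :=
  isFiniteMeasure_withDensity_ofReal hg.integrable.2

lemma real_univ_datumMeasure (hg : IsBoundedDatum C r g) :
    (datumMeasure g).real univ = ∫ z, g z := by
  have := hg.isFiniteMeasure_datumMeasure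
  have h := hg.integral_datumMeasure fun _ => (1 : ℝ)
  simpa using h

lemma ae_norm_le (hg : IsBoundedDatum C r g) : ∀ᵐ z ∂(datumMeasure g), ‖z‖ ≤ r := by
  rw [datumMeasure, ae_withDensity_iff hg.measurable.real_toNNReal.coe_nnreal_ennreal]
  refine Eventually.of_forall fun z hz => not_lt.1 fun hr => hz ?_
  simp [hg.eq_zero z hr]

end IsBoundedDatum

lemma tendsto_softening_error (c R : ℝ) : Tendsto (fun ε : ℝ =>
    3 * ε * (c * convBound R (6 * unitVol * Real.log (1 + ε⁻¹)))) (𝓝[>] 0) (𝓝 0) := by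
  have h1 : Tendsto (fun ε : ℝ => ε) (𝓝[>] 0) (𝓝 0) := tendsto_nhdsWithin_of_tendsto_nhds tendsto_id
  have h2 : Tendsto (fun ε : ℝ => ε * Real.log ε) (𝓝[>] 0) (𝓝 0) := by
    have := Real.continuous_mul_log.tendsto 0
    simp only [zero_mul] at this
    exact tendsto_nhdsWithin_of_tendsto_nhds this
  have h3 : Tendsto (fun ε : ℝ => ε * Real.log (1 + ε)) (𝓝[>] 0) (𝓝 0) := by
    have : ContinuousAt (fun ε : ℝ => ε * Real.log (1 + ε)) 0 :=
      continuousAt_id.mul ((continuousAt_const.add continuousAt_id).log (by simp))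
    have := this.tendsto
    simp only [zero_mul] at this
    exact tendsto_nhdsWithin_of_tendsto_nhds this
  have h4 := ((h3.sub h2).const_mul (3 * c * (6 * unitVol))).add
    (h1.const_mul (3 * c * volume.real (Metric.closedBall (0 : E) R)))
  simp only [sub_zero, mul_zero, add_zero] at h4
  refine h4.congr' ?_
  filter_upwards [self_mem_nhdsWithin] with ε hε
  have hε : 0 < ε := hε
  have : 1 + ε⁻¹ = (1 + ε) / ε := by field_simp; ring
  rw [this, Real.log_div (by positivity) hε.ne', convBound]
  ring

namespace IsSolution

variable {g : E → E → ℝ} {T C r : ℝ} {X V : ℝ → E → E → E} {f : E → E → ℝ → ℝ}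

lemma integrable_norm_sq (h : IsSolution g T X V f) (hg : IsBoundedDatum C r fun z => g z.1 z.2)
    {t : ℝ} (ht : t ∈ Icc 0 T) : Integrable fun z : E × E => ‖z.2‖ ^ 2 * f z.1 z.2 t := by
  obtain ⟨R, hR⟩ := h.exists_flow_bound r
  exact (h.isBoundedDatum hg ht (hR t ht)).integrable_norm_sq

lemma two_mul_kineticEnergy (h : IsSolution g T X V f)
    (hg : IsBoundedDatum C r fun z => g z.1 z.2) {t : ℝ} (ht : t ∈ Icc 0 T) :
    2 * kineticEnergy f t = ∫ z : E × E, ‖z.2‖ ^ 2 * f z.1 z.2 t := by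
  rw [Measure.volume_eq_prod, integral_prod _ (h.integrable_norm_sq hg ht), kineticEnergy]
  ring

/-- Volume preservation enters here: it identifies the energy summed over labels with the energy of
`f` at time `t`. -/
lemma kinetic_eq (h : IsSolution g T X V f)
    (hg : IsBoundedDatum C r fun z => g z.1 z.2) {t : ℝ} (ht : t ∈ Icc 0 T) :
    kinetic (datumMeasure fun z => g z.1 z.2) (fun z s => V s z.1 z.2) t = kineticEnergy f t := by
  have h1 := h.two_mul_kineticEnergy hg ht
  have h2 := h.integral_smul_eq hg ht fun z => ‖z.2‖ ^ 2
  simp only [smul_eq_mul] at h2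
  rw [kinetic, hg.integral_datumMeasure]
  have h3 : ∀ z : E × E, g z.1 z.2 • (1 / 2 * ‖V t z.1 z.2‖ ^ 2) =
      1 / 2 * (g z.1 z.2 * ‖V t z.1 z.2‖ ^ 2) := fun z => by rw [smul_eq_mul]; ring
  simp only [h3]
  rw [integral_const_mul, ← h2]
  simp only [mul_comm (f _ _ _)]
  linarith

lemma integral_eq (h : IsSolution g T X V f) (hg : IsBoundedDatum C r fun z => g z.1 z.2)
    {t : ℝ} (ht : t ∈ Icc 0 T) : ∫ z : E × E, f z.1 z.2 t = ∫ z : E × E, g z.1 z.2 := by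
  simpa using h.integral_smul_eq hg ht fun _ => (1 : ℝ)

/-- The interpolation bound for `f` at time `t` holds uniformly at the position of each particle;
integrating over the particles costs one more factor of mass. -/
lemma softPotential_le (h : IsSolution g T X V f) (hg : IsBoundedDatum C r fun z => g z.1 z.2)
    {t : ℝ} (ht : t ∈ Icc 0 T) {a s ε : ℝ} (ha : 0 < a) (hs : 0 < s) (hε : 0 < ε) :
    softPotential (datumMeasure fun z => g z.1 z.2) ε (fun z s => X s z.1 z.2) t ≤
      (∫ z : E × E, g z.1 z.2) * (1 / 2 * (s⁻¹ * (∫ z : E × E, g z.1 z.2) +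
        (a ^ 2)⁻¹ * (2 * kineticEnergy f t) + C * (6 * unitVol ^ 2 * a ^ 3 * √s))) := by
  have hfin := hg.isFiniteMeasure_datumMeasure
  obtain ⟨R, hR⟩ := h.exists_flow_bound r
  have hf := h.isBoundedDatum hg ht (hR t ht)
  have hX : Measurable fun z : E × E => X t z.1 z.2 := (h.continuous_flow_apply ht).fst.measurable
  have hm : Measurable fun p : (E × E) × E × E =>
      1 / 2 * (soft ε (X t p.1.1 p.1.2 - X t p.2.1 p.2.2))⁻¹ :=
    (((continuous_soft ε).measurable.comp ((hX.comp measurable_fst).sub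
      (hX.comp measurable_snd))).inv).const_mul _
  have hi : Integrable (fun p : (E × E) × E × E =>
      1 / 2 * (soft ε (X t p.1.1 p.1.2 - X t p.2.1 p.2.2))⁻¹)
      ((datumMeasure fun z => g z.1 z.2).prod (datumMeasure fun z => g z.1 z.2)) := by
    refine Integrable.of_bound hm.aestronglyMeasurable (1 / 2 * ε⁻¹)
      (Eventually.of_forall fun p => ?_)
    have := soft_nonneg ε (X t p.1.1 p.1.2 - X t p.2.1 p.2.2)
    rw [Real.norm_of_nonneg (by positivity)]
    gcongr
    exact le_soft _
  rw [softPotential, integral_prod _ hi, ← hg.real_univ_datumMeasure]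
  have hinner : ∀ z : E × E, ∫ z' : E × E, 1 / 2 * (soft ε (X t z.1 z.2 - X t z'.1 z'.2))⁻¹
      ∂(datumMeasure fun z => g z.1 z.2) ≤
      1 / 2 * (s⁻¹ * (datumMeasure fun z : E × E => g z.1 z.2).real univ +
        (a ^ 2)⁻¹ * (2 * kineticEnergy f t) + C * (6 * unitVol ^ 2 * a ^ 3 * √s)) := by
    intro z
    have h1 := h.integral_smul_eq hg ht fun z' => (soft ε (X t z.1 z.2 - z'.1))⁻¹
    have h2 := hf.integral_inv_soft_le ha hs hε (X t z.1 z.2)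
    simp only [smul_eq_mul] at h1
    rw [integral_const_mul, hg.integral_datumMeasure]
    simp only [smul_eq_mul]
    rw [← h1, hg.real_univ_datumMeasure, ← h.integral_eq hg ht, h.two_mul_kineticEnergy hg ht]
    gcongr
  refine (integral_mono hi.integral_prod_left (integrable_const _) hinner).trans (le_of_eq ?_)
  rw [integral_const, smul_eq_mul]

/-- **Energy inequality**: up to an arbitrarily small softening, the increase of the kinetic energy
is bounded by the gravitational energy. -/
lemma exists_kineticEnergy_le (h : IsSolution g T X V f)
    (hg : IsBoundedDatum C r fun z => g z.1 z.2) {t : ℝ} (ht : t ∈ Icc 0 T) {η : ℝ} (hη : 0 < η) :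
    ∃ ε > 0, kineticEnergy f t ≤ kineticEnergy f 0 +
      softPotential (datumMeasure fun z => g z.1 z.2) ε (fun z s => X s z.1 z.2) t + η := by
  have hfin := hg.isFiniteMeasure_datumMeasure
  obtain ⟨R, hR⟩ := h.exists_flow_bound r
  have hρ := h.isBoundedDensity_cutDensity hg hR
  set c := C * volume.real (Metric.closedBall (0 : E) R) with hc
  have h0 : (0 : ℝ) ∈ Icc 0 T := ⟨le_rfl, ht.1.trans ht.2⟩
  set m := (datumMeasure fun z : E × E => g z.1 z.2).real univ with hm
  -- `R` bounds the velocities of all particles up to time `T`. It only multiplies a quantity that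
  -- tends to zero, so its size is irrelevant.
  have hlim := ((tendsto_softening_error c R).const_mul (R * m * t))
  rw [mul_zero] at hlim
  obtain ⟨ε, hε1, hε⟩ := ((hlim.eventually_lt_const hη).and self_mem_nhdsWithin).exists
  refine ⟨ε, hε, ?_⟩
  have hflow := fun s hs => (h.continuous_flow_apply (t := s) hs).measurable
  have hX : ∀ s ∈ Icc 0 T, Measurable fun z : E × E => X s z.1 z.2 := fun s hs => (hflow s hs).fst
  have hV : ∀ s ∈ Icc 0 T, Measurable fun z : E × E => V s z.1 z.2 := fun s hs => (hflow s hs).snd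
  have key := abs_energy_sub_le (μ := datumMeasure fun z => g z.1 z.2) (ε := ε) (W := R)
    (e := 3 * ε * (c * convBound R (6 * unitVol * Real.log (1 + ε⁻¹))))
    (x := fun z s => X s z.1 z.2) (v := fun z s => V s z.1 z.2) hε h.isTrajectory hX hV
    (fun s hs => (measurable_softField (h.measurable_cutDensity hg.measurable) 0).comp
      ((hX s hs).prodMk measurable_const))
    (fun y s => (hρ s).norm_softField_le 0 y)
    (by
      filter_upwards [hg.ae_norm_le] with z hz s hs
      exact (norm_snd_le _).trans (hR s hs z hz))
    (fun s hs z => by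
      have h1 := (hρ s).norm_softField_zero_sub_le hε (X s z.1 z.2)
      have h2 : softField ε (cutDensity f T s) (X s z.1 z.2) =
          -∫ z' : E × E, softKernel ε (X s z.1 z.2 - X s z'.1 z'.2)
            ∂(datumMeasure fun z => g z.1 z.2) := by
        rw [cutDensity_of_mem hs, hg.integral_datumMeasure]
        rw [((h.isBoundedDatum hg hs (hR s hs)).softField_eq ε (X s z.1 z.2)).2]
        rw [h.integral_smul_eq hg hs fun z' => softKernel ε (X s z.1 z.2 - z'.1)]
      rwa [h2, sub_neg_eq_add] at h1) ht
  rw [h.kinetic_eq hg ht, h.kinetic_eq hg h0] at key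
  have hP0 : 0 ≤ softPotential (datumMeasure fun z => g z.1 z.2) ε (fun z s => X s z.1 z.2) 0 :=
    integral_nonneg fun p => by
      have := soft_nonneg ε (X 0 p.1.1 p.1.2 - X 0 p.2.1 p.2.2)
      positivity
  have := (abs_le.1 key).2
  linarith

/-- The kinetic energy is bounded by the initial one and the power `7/3` of the mass. -/
theorem kineticEnergy_le (h : IsSolution g T X V f)
    (hg : IsBoundedDatum C r fun z => g z.1 z.2) {t : ℝ} (ht : t ∈ Icc 0 T) {M : ℝ} (hM : 0 < M)
    (hgM : ∫ z : E × E, g z.1 z.2 ≤ M) :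
    kineticEnergy f t ≤ 2 * kineticEnergy f 0 +
      (1 + 24 * C * unitVol ^ 2) * M ^ (7 / 3 : ℝ) := by
  have hC := hg.nonneg_bound
  have h0 : (0 : ℝ) ∈ Icc 0 T := ⟨le_rfl, ht.1.trans ht.2⟩
  have hK0 : 0 ≤ 2 * kineticEnergy f t := by
    obtain ⟨R, hR⟩ := h.exists_flow_bound r
    rw [h.two_mul_kineticEnergy hg ht]
    exact integral_nonneg fun z =>
      mul_nonneg (by positivity) ((h.isBoundedDatum hg ht (hR t ht)).nonneg z)
  set m := ∫ z : E × E, g z.1 z.2 with hm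
  have hm0 : 0 ≤ m := integral_nonneg fun z => hg.nonneg z
  set K := kineticEnergy f t with hK
  -- A sixth root of `M` turns every power below into an integer power of `q`.
  obtain ⟨q, hq0, hq⟩ : ∃ q : ℝ, 0 < q ∧ q ^ 6 = M :=
    ⟨M ^ (1 / 6 : ℝ), by positivity, by
      rw [← Real.rpow_natCast, ← Real.rpow_mul hM.le]; norm_num⟩
  have hM73 : M ^ (7 / 3 : ℝ) = q ^ 14 := by
    rw [← hq, ← Real.rpow_natCast q 6, ← Real.rpow_mul hq0.le, ← Real.rpow_natCast q 14]; norm_num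
  -- `a ^ 2 = 2 * M` makes the kinetic term at most `K / 2`. With `s = M ^ (-1/3)` below, the far
  -- term `M ^ 2 / s` and the slow term `M * a ^ 3 * √s` both scale like `M ^ (7/3)`.
  set a := √2 * q ^ 3 with ha
  have ha0 : 0 < a := by positivity
  have ha2 : a ^ 2 = 2 * M := by
    rw [ha, mul_pow, Real.sq_sqrt (by norm_num), ← hq]; ring
  have ha3 : a ^ 3 ≤ 4 * q ^ 9 := by
    have h2 : √2 ≤ 2 := by rw [Real.sqrt_le_left (by norm_num)]; norm_num
    have : a ^ 3 = 2 * √2 * q ^ 9 := by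
      rw [ha, mul_pow, pow_succ, Real.sq_sqrt (by norm_num)]; ring
    rw [this]
    gcongr
    linarith
  set s := (q ^ 2)⁻¹ with hs
  have hs0 : 0 < s := by positivity
  have hss : √s = q⁻¹ := by rw [hs, Real.sqrt_inv, Real.sqrt_sq hq0.le]
  refine le_of_forall_pos_le_add fun η hη => ?_
  -- Half of `η`, because absorbing `K / 2` on the left doubles the rest.
  obtain ⟨ε, hε, hle⟩ := h.exists_kineticEnergy_le hg ht (half_pos hη)
  have hP := h.softPotential_le hg ht ha0 hs0 hε
  rw [← hm, ← hK] at hP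
  have hP' : m * (1 / 2 * (s⁻¹ * m + (a ^ 2)⁻¹ * (2 * K) + C * (6 * unitVol ^ 2 * a ^ 3 * √s))) ≤
      1 / 2 * K + 1 / 2 * ((1 + 24 * C * unitVol ^ 2) * q ^ 14) := by
    calc _ ≤ M * (1 / 2 * (s⁻¹ * M + (a ^ 2)⁻¹ * (2 * K) +
          C * (6 * unitVol ^ 2 * (4 * q ^ 9) * √s))) := by gcongr
      _ = 1 / 2 * K + 1 / 2 * ((1 + 24 * C * unitVol ^ 2) * q ^ 14) := by
        rw [ha2, hss, hs, ← hq]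
        field_simp
        ring
  rw [hM73]
  linarith

end IsSolution

/-! ### Mass and kinetic energy of the truncated datum -/

lemma integrable_norm_pow_mul_gaussian {lam : ℝ} (hlam : 0 < lam) (k : ℕ) :
    Integrable fun v : E => ‖v‖ ^ k * Real.exp (-lam * ‖v‖ ^ 2) := by
  refine (integrable_fun_norm_addHaar (volume : Measure E)
    (f := fun r => r ^ k * Real.exp (-lam * r ^ 2))).2 ?_
  have h := (integrable_rpow_mul_exp_neg_mul_sq hlam (s := ((2 + k : ℕ) : ℝ))
    (by linarith [(Nat.cast_nonneg (2 + k) : (0 : ℝ) ≤ _)])).integrableOn (s := Ioi 0)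
  refine h.congr_fun (fun y _ => ?_) measurableSet_Ioi
  simp only [Real.rpow_natCast, finrank_E, smul_eq_mul]
  rw [← mul_assoc, ← pow_add]

/-- The spatial decay `(1 + |x|)^{-α}` of the datum, cut off at radius `s`. -/
noncomputable def cutDecay (α s : ℝ) : E → ℝ :=
  (Metric.ball (0 : E) s).indicator fun x => 1 / (1 + ‖x‖) ^ α

/-- Replacing `1 + y` by `y` keeps the growth rate, and `y ^ (2 - α)` is integrable at the origin
because `α < 3`. -/
lemma integral_cutDecay_le {α s : ℝ} (hα0 : 0 < α) (hα : α < 3) (hs : 0 ≤ s) :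
    Integrable (cutDecay α s) ∧
      ∫ x, cutDecay α s x ≤ 3 * unitVol * (s ^ (3 - α) / (3 - α)) := by
  have hle : ∀ y ∈ Ioo 0 s, y ^ 2 * (1 / (1 + y) ^ α) ≤ y ^ (2 - α) := by
    intro y hy
    have hy0 := hy.1
    rw [Real.rpow_sub hy0, Real.rpow_two, mul_one_div]
    gcongr
    linarith
  have hI : IntegrableOn (fun y : ℝ => y ^ (2 - α)) (Ioo 0 s) := by
    have := intervalIntegral.intervalIntegrable_rpow' (a := 0) (b := s)
      (by linarith : (-1 : ℝ) < 2 - α)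
    rw [intervalIntegrable_iff_integrableOn_Ioc_of_le hs] at this
    exact this.mono_set Ioo_subset_Ioc_self
  have hI' : IntegrableOn (fun y : ℝ => y ^ 2 * (1 / (1 + y) ^ α)) (Ioo 0 s) := by
    refine Integrable.mono' hI (Measurable.aestronglyMeasurable (by fun_prop)) ?_
    refine (ae_restrict_iff' measurableSet_Ioo).2 (Eventually.of_forall fun y hy => ?_)
    have := hy.1
    rw [Real.norm_of_nonneg (by positivity)]
    exact hle y hy
  refine ⟨(integrable_indicator_iff Metric.isOpen_ball.measurableSet).2
    (integrableOn_ball_norm (f := fun y => 1 / (1 + y) ^ α) hI'), ?_⟩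
  rw [cutDecay, integral_indicator Metric.isOpen_ball.measurableSet,
    setIntegral_ball_norm (fun y => 1 / (1 + y) ^ α) s]
  have hv := unitVol_nonneg
  unfold unitVol at *
  gcongr
  refine (setIntegral_mono_on hI' hI measurableSet_Ioo hle).trans (le_of_eq ?_)
  rw [← integral_Ioc_eq_integral_Ioo, ← intervalIntegral.integral_of_le hs,
    integral_rpow (Or.inl (by linarith)), Real.zero_rpow (by linarith)]
  have : 2 - α + 1 = 3 - α := by ring
  rw [this, sub_zero]

section datum

variable {α β lam C₁ N : ℝ} {f₀ : E → E → ℝ}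

lemma truncate_eq (f₀ : E → E → ℝ) (β N : ℝ) (x v : E) :
    truncate f₀ β N x v = {z : E × E | ‖z.1‖ ≤ N ^ β ∧ ‖z.2‖ ≤ N}.indicator
      (fun z => f₀ z.1 z.2) (x, v) := by
  by_cases h1 : ‖x‖ ≤ N ^ β <;> by_cases h2 : ‖v‖ ≤ N <;> simp [truncate, indicator, h1, h2]

lemma isBoundedDatum_truncate (hα : 0 < α) (hlam : 0 < lam) (hC₁ : 0 < C₁)
    (hm : Measurable fun p : E × E => f₀ p.1 p.2)
    (hf : ∀ x v, 0 ≤ f₀ x v ∧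
      f₀ x v ≤ C₁ * Real.exp (-lam * ‖v‖ ^ 2) * (1 / (1 + ‖x‖) ^ α)) :
    IsBoundedDatum C₁ (max (N ^ β) N) fun z => truncate f₀ β N z.1 z.2 where
  measurable := by
    simp only [truncate_eq]
    have h1 : Measurable fun z : E × E => ‖z.1‖ := by fun_prop
    have h2 : Measurable fun z : E × E => ‖z.2‖ := by fun_prop
    exact hm.indicator ((measurableSet_le h1 measurable_const).inter
      (measurableSet_le h2 measurable_const))
  nonneg z := by
    rw [truncate_eq]
    exact indicator_nonneg (fun z _ => (hf z.1 z.2).1) _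
  le z := by
    rw [truncate_eq]
    refine indicator_le_self' (fun z _ => (hf z.1 z.2).1) _ |>.trans ((hf z.1 z.2).2.trans ?_)
    have e1 : Real.exp (-lam * ‖z.2‖ ^ 2) ≤ 1 := by
      rw [Real.exp_le_one_iff]; nlinarith [sq_nonneg ‖z.2‖]
    have e2 : 1 / (1 + ‖z.1‖) ^ α ≤ 1 := by
      have := Real.one_le_rpow (by linarith [norm_nonneg z.1] : 1 ≤ 1 + ‖z.1‖) hα.le
      exact (div_le_one (by linarith)).2 this
    calc C₁ * Real.exp (-lam * ‖z.2‖ ^ 2) * (1 / (1 + ‖z.1‖) ^ α) ≤ C₁ * 1 * 1 := by gcongr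
      _ = C₁ := by ring
  eq_zero z hz := by
    rw [truncate_eq]
    refine indicator_of_notMem (fun h => ?_) _
    rw [Prod.norm_def] at hz
    exact absurd (max_le_max h.1 h.2) (not_le.2 hz)

lemma truncate_le (hC₁ : 0 < C₁) (hN : 1 ≤ N)
    (hf : ∀ x v, 0 ≤ f₀ x v ∧
      f₀ x v ≤ C₁ * Real.exp (-lam * ‖v‖ ^ 2) * (1 / (1 + ‖x‖) ^ α)) (x v : E) :
    truncate f₀ β N x v ≤
      C₁ * (cutDecay α (2 * N ^ β) x * Real.exp (-lam * ‖v‖ ^ 2)) := by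
  have hNβ : 0 < N ^ β := by positivity
  have h0 : 0 ≤ cutDecay α (2 * N ^ β) x := indicator_nonneg (fun _ _ => by positivity) _
  rw [truncate_eq]
  refine indicator_le' (fun z hz => ?_) (fun z _ => ?_) (x, v) (g := fun z : E × E =>
    C₁ * (cutDecay α (2 * N ^ β) z.1 * Real.exp (-lam * ‖z.2‖ ^ 2)))
  · have hx : z.1 ∈ Metric.ball (0 : E) (2 * N ^ β) := by
      rw [mem_ball_zero_iff]
      linarith [hz.1]
    rw [cutDecay, indicator_of_mem hx]
    refine (hf z.1 z.2).2.trans (le_of_eq ?_)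
    ring
  · have : 0 ≤ cutDecay α (2 * N ^ β) z.1 := indicator_nonneg (fun _ _ => by positivity) _
    positivity

/-- Velocity moments of the truncated datum. -/
lemma moment_truncate_le (hα : 0 < α) (hα' : α < 3) (hlam : 0 < lam) (hC₁ : 0 < C₁) (hN : 1 ≤ N)
    (hm : Measurable fun p : E × E => f₀ p.1 p.2)
    (hf : ∀ x v, 0 ≤ f₀ x v ∧
      f₀ x v ≤ C₁ * Real.exp (-lam * ‖v‖ ^ 2) * (1 / (1 + ‖x‖) ^ α)) (k : ℕ) :
    ∫ z : E × E, ‖z.2‖ ^ k * truncate f₀ β N z.1 z.2 ≤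
      C₁ * (3 * unitVol * (2 ^ (3 - α) / (3 - α)) *
        ∫ v : E, ‖v‖ ^ k * Real.exp (-lam * ‖v‖ ^ 2)) * N ^ (β * (3 - α)) := by
  obtain ⟨h1, h2⟩ := integral_cutDecay_le hα hα' (by positivity : 0 ≤ 2 * N ^ β)
  have hg := isBoundedDatum_truncate (β := β) (N := N) hα hlam hC₁ hm hf
  have hI := (h1.mul_prod (integrable_norm_pow_mul_gaussian hlam k)).const_mul C₁
  have hle : ∀ z : E × E, ‖z.2‖ ^ k * truncate f₀ β N z.1 z.2 ≤
      C₁ * (cutDecay α (2 * N ^ β) z.1 * (‖z.2‖ ^ k * Real.exp (-lam * ‖z.2‖ ^ 2))) := fun z => by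
    have := mul_le_mul_of_nonneg_left (truncate_le (β := β) hC₁ hN hf z.1 z.2)
      (by positivity : 0 ≤ ‖z.2‖ ^ k)
    linarith
  have hI0 : Integrable fun z : E × E => ‖z.2‖ ^ k * truncate f₀ β N z.1 z.2 :=
    hg.integrable_mul (φ := fun z => ‖z.2‖ ^ k) (by fun_prop) (b := max (N ^ β) N ^ k)
      fun z hz => by
        rw [norm_pow, norm_norm]
        gcongr
        exact (norm_snd_le z).trans hz
  have hG : 0 ≤ ∫ v : E, ‖v‖ ^ k * Real.exp (-lam * ‖v‖ ^ 2) :=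
    integral_nonneg fun v => by positivity
  refine (integral_mono hI0 hI hle).trans ?_
  rw [integral_const_mul, Measure.volume_eq_prod,
    integral_prod_mul (cutDecay α (2 * N ^ β)) fun v : E => ‖v‖ ^ k * Real.exp (-lam * ‖v‖ ^ 2)]
  have hpow : (2 * N ^ β) ^ (3 - α) = 2 ^ (3 - α) * N ^ (β * (3 - α)) := by
    rw [Real.mul_rpow (by norm_num) (by positivity), ← Real.rpow_mul (by linarith)]
  rw [hpow] at h2
  have := mul_le_mul_of_nonneg_left (mul_le_mul_of_nonneg_right h2 hG) hC₁.le
  refine this.trans (le_of_eq ?_)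
  ring

end datum

end GravVP

/-! ### Choice of the constant -/

theorem mainTheorem2 (α β lam C₁ : ℝ) (hα : 1 < α) (hα' : α < 3) (hβ : 0 < β)
    (hlam : 0 < lam) (hC₁ : 0 < C₁) :
    ∃ C : ℝ, 0 < C ∧
      ∀ f₀ : GravVP.E → GravVP.E → ℝ,
        Measurable (fun p : GravVP.E × GravVP.E => f₀ p.1 p.2) →
        (∀ x v, 0 ≤ f₀ x v ∧
          f₀ x v ≤ C₁ * Real.exp (-lam * ‖v‖ ^ 2) * (1 / (1 + ‖x‖) ^ α)) →
        ∀ (N : ℝ), 1 ≤ N → ∀ (T : ℝ), 0 < T →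
        ∀ (X V : ℝ → GravVP.E → GravVP.E → GravVP.E) (f : GravVP.E → GravVP.E → ℝ → ℝ),
          GravVP.IsSolution (GravVP.truncate f₀ β N) T X V f →
          ∀ t ∈ Set.Icc 0 T,
            MeasureTheory.Integrable
              (fun p : GravVP.E × GravVP.E => ‖p.2‖ ^ 2 * f p.1 p.2 t) ∧
            GravVP.kineticEnergy f t ≤ C * N ^ (7 / 3 * β * (3 - α)) := by
  have hα0 : 0 < α := by linarith
  have hα3 : 0 < 3 - α := by linarith
  have hv := GravVP.unitVol_nonneg
  set A : ℕ → ℝ := fun k => C₁ * (3 * GravVP.unitVol * (2 ^ (3 - α) / (3 - α)) *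
    ∫ v : GravVP.E, ‖v‖ ^ k * Real.exp (-lam * ‖v‖ ^ 2)) with hA
  have hA0 : ∀ k, 0 ≤ A k := fun k => by
    have : 0 ≤ ∫ v : GravVP.E, ‖v‖ ^ k * Real.exp (-lam * ‖v‖ ^ 2) :=
      integral_nonneg fun v => by positivity
    simp only [hA]
    positivity
  -- `A k` bounds the `k`-th velocity moment in units of `N ^ (β * (3 - α))`; the `+ 1` supplies the
  -- strictly positive mass bound that `kineticEnergy_le` requires.
  have hA1 : 0 < A 0 + 1 := by linarith [hA0 0]
  refine ⟨A 2 + (1 + 24 * C₁ * GravVP.unitVol ^ 2) * (A 0 + 1) ^ (7 / 3 : ℝ),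
    add_pos_of_nonneg_of_pos (hA0 2) (by positivity), ?_⟩
  intro f₀ hm hf N hN T hT X V f h t ht
  have hN0 : 0 < N := by linarith
  have hg := GravVP.isBoundedDatum_truncate (β := β) (N := N) hα0 hlam hC₁ hm hf
  refine ⟨h.integrable_norm_sq hg ht, ?_⟩
  have hmom := GravVP.moment_truncate_le (β := β) hα0 hα' hlam hC₁ hN hm hf
  have hP : 0 < N ^ (β * (3 - α)) := by positivity
  have hmass : ∫ z : GravVP.E × GravVP.E, GravVP.truncate f₀ β N z.1 z.2 ≤
      (A 0 + 1) * N ^ (β * (3 - α)) := by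
    have := hmom 0
    simp only [pow_zero, one_mul] at this
    refine this.trans ?_
    simp only [hA, pow_zero, one_mul]
    gcongr
    linarith
  have h0 : (0 : ℝ) ∈ Icc 0 T := ⟨le_rfl, hT.le⟩
  have hK0 : 2 * GravVP.kineticEnergy f 0 ≤ A 2 * N ^ (β * (3 - α)) := by
    rw [h.two_mul_kineticEnergy hg h0]
    have hf0 : ∀ x v, f x v 0 = GravVP.truncate f₀ β N x v := fun x v => by
      simpa [h.init_X, h.init_V] using h.transport x v 0 h0
    simp only [hf0]
    exact hmom 2
  -- Since `1 ≤ N`, the initial energy, with the smaller exponent, is dominated by the mass term.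
  have hexp : N ^ (β * (3 - α)) ≤ N ^ (7 / 3 * β * (3 - α)) := by
    refine Real.rpow_le_rpow_of_exponent_le hN ?_
    nlinarith [mul_pos hβ hα3]
  have hM73 : ((A 0 + 1) * N ^ (β * (3 - α))) ^ (7 / 3 : ℝ) =
      (A 0 + 1) ^ (7 / 3 : ℝ) * N ^ (7 / 3 * β * (3 - α)) := by
    rw [Real.mul_rpow hA1.le hP.le, ← Real.rpow_mul hN0.le]
    congr 2
    ring
  have key := h.kineticEnergy_le hg ht (mul_pos hA1 hP) hmass
  rw [hM73] at key
  have := mul_le_mul_of_nonneg_left hexp (hA0 2)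
  linarith
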